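/- Let $N\ge 2$ be an integer, $s\in(0,1)$, and $$\mu_0:=-2^{2s}\,\frac{\Gamma^2\!\left(\frac{N+2s}{4}\right)}{\Gamma^2\!\left(\frac{N-2s}{4}\right)}<0,\qquad C_{N,s}:=2^{2s}\pi^{-N/2}\,s\,\frac{\Gamma\!\left(\frac{N+2s}{2}\right)}{\Gamma(1-s)},$$ and define the fractional Laplacian pointwise by $$(-\Delta)^s u(x)=C_{N,s}\lim_{\varepsilon\to0^+}\int_{\mathbb{R}^N\setminus B_\varepsilon(x)}\frac{u(x)-u(z)}{|x-z|^{N+2s}}\,dz .$$ By a classical solution of $$(-\Delta)^s u+\frac{\mu}{|x|^{2s}}\,u=0\quad\text{in }\mathbb{R}^N\setminus\{0\}\qquad(\ast)$$ we mean a function $u$ for which, at every $x\ne0$, the integrals above converge absolutely for all $\varepsilon>0$, the limit exists in $\mathbb{R}$, and the equation holds. Then for every $\mu\ge\mu_0$ there exist a unique $\tau_-(\mu)\in\left(-N,\frac{2s-N}{2}\right]$ and a unique $\tau_+(\mu)\in\left[\frac{2s-N}{2},2s\right)$ (depending also on $N$ and $s$) such that the functions $$\Phi_\mu(x)=\begin{cases}|x|^{\tau_-(\mu)}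 & \text{if }\mu>\mu_0,\\ -|x|^{\tau_-(\mu)}\ln|x| & \text{if }\mu=\mu_0,\end{cases}\qquad\text{and}\qquad \Gamma_\mu(x)=|x|^{\tau_+(\mu)}$$ are classical solutions of $(\ast)$ (each exponent being unique in its own interval with the respective property); moreover $$\Phi_\mu,\ \Gamma_\mu\in L^1\!\left(\mathbb{R}^N,\tfrac{dx}{1+|x|^{N+2s}}\right)\cap C^\infty(\mathbb{R}^N\setminus\{0\}).$$ Furthermore, $\mu\mapsto\tau_-(\mu)$ is continuous and strictly decreasing on $[\mu_0,\infty)$, and $\mu\mapsto\tau_+(\mu)$ is continuous and strictly increasing on $[\mu_0,\infty)$. In addition, $$\tau_-(\mu)+\tau_+(\mu)=2s-N\quad\text{for all }\mu\ge\mu_0,\qquad \tau_-(\mu_0)=\tau_+(\mu_0)=\frac{2s-N}{2},$$ $$\tau_-(0)=2s-N,\qquad \tau_+(0)=0,\qquad \lim_{\mu\to+\infty}\tau_-(\mu)=-N,\qquad \lim_{\mu\to+\infty}\tau_+(\mu)=2s .$$ -/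

import Mathlib

open scoped ContDiff

noncomputable section

namespace FracHardy

/-- The normalization constant `C_{N,s}` of the fractional Laplacian. -/
def normConst (N : ℕ) (s : ℝ) : ℝ :=
  (2 : ℝ) ^ (2 * s) * Real.pi ^ (-((N : ℝ) / 2)) * s * Real.Gamma (((N : ℝ) + 2 * s) / 2)
    / Real.Gamma (1 - s)

/-- The negative of the best constant in the fractional Hardy inequality. -/
def criticalMu (N : ℕ) (s : ℝ) : ℝ :=
  -((2 : ℝ) ^ (2 * s) * (Real.Gamma (((N : ℝ) + 2 * s) / 4)) ^ 2
    / (Real.Gamma (((N : ℝ) - 2 * s) / 4)) ^ 2)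

/-- `(-Δ)^s u (x)` exists and equals `l`: the truncated integrals over the complements of the
balls `B_ε(x)` are Lebesgue integrals and `C_{N,s}` times them converges to `l` as `ε → 0⁺`. -/
def HasFracLaplacianAt {N : ℕ} (s : ℝ) (u : EuclideanSpace ℝ (Fin N) → ℝ)
    (x : EuclideanSpace ℝ (Fin N)) (l : ℝ) : Prop :=
  (∀ ε : ℝ, 0 < ε → MeasureTheory.IntegrableOn
      (fun z => (u x - u z) / ‖x - z‖ ^ ((N : ℝ) + 2 * s)) (Metric.ball x ε)ᶜ) ∧
  Filter.Tendsto
    (fun ε : ℝ => normConst N s *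
      ∫ z in (Metric.ball x ε)ᶜ, (u x - u z) / ‖x - z‖ ^ ((N : ℝ) + 2 * s))
    (nhdsWithin 0 (Set.Ioi 0)) (nhds l)

/-- `u` solves `(-Δ)^s u + μ |x|^{-2s} u = 0` pointwise in `ℝ^N ∖ {0}`. -/
def SolvesHardy {N : ℕ} (s μ : ℝ) (u : EuclideanSpace ℝ (Fin N) → ℝ) : Prop :=
  ∀ x : EuclideanSpace ℝ (Fin N), x ≠ 0 →
    ∃ l : ℝ, HasFracLaplacianAt s u x l ∧ l + μ / ‖x‖ ^ (2 * s) * u x = 0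

/-- `u ∈ L¹(ℝ^N, dx / (1 + |x|^{N+2s})) ∩ C^∞(ℝ^N ∖ {0})`. -/
def IsAdmissible {N : ℕ} (s : ℝ) (u : EuclideanSpace ℝ (Fin N) → ℝ) : Prop :=
  MeasureTheory.Integrable (fun x => u x / (1 + ‖x‖ ^ ((N : ℝ) + 2 * s))) ∧
  ContDiffOn ℝ ∞ u {0}ᶜ

/-- The candidate singular solution with exponent `τ`: it is `|x|^τ`, and `-|x|^τ ln |x|` for the
critical value of `μ`. -/
def Phi (N : ℕ) (s μ τ : ℝ) (x : EuclideanSpace ℝ (Fin N)) : ℝ :=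
  if μ = criticalMu N s then -(‖x‖ ^ τ * Real.log ‖x‖) else ‖x‖ ^ τ

/-- The candidate regular solution with exponent `τ`. -/
def Gam (N : ℕ) (τ : ℝ) (x : EuclideanSpace ℝ (Fin N)) : ℝ := ‖x‖ ^ τ

end FracHardy

end

/-!
The function `|x|^τ` is homogeneous and radial, so `(-Δ)^s |x|^τ = c(τ) |x|^(τ - 2s)` for
`-N < τ < 2s`, and `|x|^τ` solves the equation exactly when `c(τ) = -μ`. Everything reduces to the
function `c` (`symbol`).

*Principal value.* At a unit vector `e` split the truncated integral along the unit sphere and fold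
the inner part outwards by the inversion `w ↦ w / |w|²`, for which `|e - w / |w|²| = |e - w| / |w|`.
With `r = |w|` the two parts combine to the absolutely convergent integral
`c(τ) = C_{N,s} ∫_{|w| > 1} (1 - r^τ) (1 - r^(2s - N - τ)) |e - w|^{-(N+2s)} dw`,
because the integrand vanishes to second order on the sphere
(`tendsto_setIntegral_compl_ball`, `hasFracLaplacianAt_rpow`). The formula shows that `c` is symmetric
about `(2s - N)/2`, concave and hence continuous, strictly decreasing to the right of the centre,
zero at `0`, and that it tends to `-∞` at `2s`. So `-c` is a continuous increasing bijection from
`[(2s - N)/2, 2s)` onto a half-line; its inverse is `τ₊`, and `τ₋ = 2s - N - τ₊`. The same folding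
for `|x|^τ log |x|` gives an integrand of constant sign which vanishes identically exactly at
`τ = (2s - N)/2`; this settles the logarithmic solution and its uniqueness.

*Value at the centre.* It remains to see that `c((2s - N)/2) = -μ₀` (`symbol_critical`). Test the
truncated operator applied to `u = |x|^{-2b}`, `b = (N - 2s)/4`, against `v = e^{-|x|²}`. By scaling
the result tends to a multiple of `c` as the truncation is removed. By Fubini it is also
`∫ |y|^{-(N+2s)} B(y) dy` over `|y| ≥ ε`, where `B(y) = ∫ v(x) (u(x) - u(x + y)) dx`. As `u` is a
superposition of the Gaussians `e^{-l |x|²}` with weight `l^(b - 1) / Γ(b)`, `B` is a superposition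
of the nonnegative functions `1 - e^{-κ |y|²}`, `κ = l / (1 + l)`, and the limit is a product of
Gamma and beta integrals. The surface measure of the sphere enters both sides and cancels.
-/

namespace FracHardy

open MeasureTheory Set Metric Filter Topology

variable {N : ℕ} {s : ℝ}

/-! ### Integrability of powers against the kernel -/

lemma integrable_norm_rpow_div (hN : 1 ≤ N) {γ : ℝ} (h1 : -(N : ℝ) < γ)
    (h2 : γ < 2 * s) :
    Integrable (fun x : EuclideanSpace ℝ (Fin N) => ‖x‖ ^ γ / (1 + ‖x‖ ^ ((N : ℝ) + 2 * s))) := by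
  have : Nonempty (Fin N) := ⟨⟨0, hN⟩⟩
  rw [integrable_fun_norm_addHaar volume
    (f := fun r : ℝ => r ^ γ / (1 + r ^ ((N : ℝ) + 2 * s)))]
  simp only [finrank_euclideanSpace, Fintype.card_fin, smul_eq_mul]
  have hmeas : Measurable fun y : ℝ => y ^ (N - 1) * (y ^ γ / (1 + y ^ ((N : ℝ) + 2 * s))) := by
    fun_prop
  have hpow : ∀ y : ℝ, 0 < y → y ^ (N - 1) * y ^ γ = y ^ ((N : ℝ) - 1 + γ) := by
    intro y hy
    rw [Real.rpow_add hy, ← Real.rpow_natCast y (N - 1), Nat.cast_sub hN, Nat.cast_one]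
  rw [← Ioc_union_Ioi_eq_Ioi zero_le_one]
  refine IntegrableOn.union ?_ ?_
  · have hi : IntegrableOn (fun y : ℝ => y ^ ((N : ℝ) - 1 + γ)) (Ioc 0 1) :=
      (intervalIntegrable_iff_integrableOn_Ioc_of_le zero_le_one).1
        (intervalIntegral.intervalIntegrable_rpow' (by linarith))
    refine Integrable.mono' hi hmeas.aestronglyMeasurable ?_
    refine (ae_restrict_mem measurableSet_Ioc).mono fun y hy => ?_
    have hy0 : 0 < y := hy.1
    rw [Real.norm_of_nonneg (by positivity), ← mul_div_assoc, hpow y hy0]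
    exact div_le_self (by positivity) (by linarith [Real.rpow_nonneg hy0.le ((N : ℝ) + 2 * s)])
  · have hi : IntegrableOn (fun y : ℝ => y ^ (γ - 2 * s - 1)) (Ioi 1) :=
      integrableOn_Ioi_rpow_of_lt (by linarith) zero_lt_one
    refine Integrable.mono' hi hmeas.aestronglyMeasurable ?_
    refine (ae_restrict_mem measurableSet_Ioi).mono fun y hy => ?_
    have hy0 : 0 < y := lt_trans zero_lt_one hy
    rw [Real.norm_of_nonneg (by positivity), ← mul_div_assoc, hpow y hy0,
      div_le_iff₀ (by positivity), mul_add, ← Real.rpow_add hy0]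
    have : y ^ (γ - 2 * s - 1 + ((N : ℝ) + 2 * s)) = y ^ ((N : ℝ) - 1 + γ) := by ring_nf
    rw [this]
    linarith [Real.rpow_nonneg hy0.le (γ - 2 * s - 1)]

lemma abs_rpow_mul_log_le {γ η r : ℝ} (hη : 0 < η) (hr : 0 ≤ r) :
    |r ^ γ * Real.log r| ≤ (r ^ (γ + η) + r ^ (γ - η)) / η := by
  rcases hr.eq_or_lt with rfl | hr
  · simp only [Real.log_zero, mul_zero, abs_zero]
    positivity
  have h1 : Real.log r ≤ r ^ η / η := Real.log_le_rpow_div hr.le hη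
  have h2 : -Real.log r ≤ r ^ (-η) / η := by
    rw [← Real.log_inv, Real.rpow_neg hr.le, ← Real.inv_rpow hr.le]
    exact Real.log_le_rpow_div (by positivity) hη
  have h3 : |Real.log r| ≤ (r ^ η + r ^ (-η)) / η := by
    have : 0 ≤ r ^ η / η := by positivity
    have : 0 ≤ r ^ (-η) / η := by positivity
    rw [add_div]
    exact abs_le.2 ⟨by linarith, by linarith⟩
  rw [abs_mul, abs_of_nonneg (by positivity : 0 ≤ r ^ γ)]
  calc r ^ γ * |Real.log r| ≤ r ^ γ * ((r ^ η + r ^ (-η)) / η) := by gcongr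
    _ = (r ^ (γ + η) + r ^ (γ - η)) / η := by
      rw [sub_eq_add_neg, Real.rpow_add hr, Real.rpow_add hr]; ring

lemma integrable_norm_rpow_mul_log_div (hN : 1 ≤ N) {γ : ℝ} (h1 : -(N : ℝ) < γ)
    (h2 : γ < 2 * s) :
    Integrable (fun x : EuclideanSpace ℝ (Fin N) =>
      ‖x‖ ^ γ * Real.log ‖x‖ / (1 + ‖x‖ ^ ((N : ℝ) + 2 * s))) := by
  obtain ⟨η, hη, hη1, hη2⟩ : ∃ η : ℝ, 0 < η ∧ -(N : ℝ) < γ - η ∧ γ + η < 2 * s := by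
    refine ⟨min (γ + N) (2 * s - γ) / 2, ?_, ?_, ?_⟩
    · have : 0 < min (γ + N) (2 * s - γ) := lt_min (by linarith) (by linarith)
      positivity
    · linarith [min_le_left (γ + N) (2 * s - γ)]
    · linarith [min_le_right (γ + N) (2 * s - γ)]
  have hi := ((integrable_norm_rpow_div hN (s := s) (γ := γ + η) (by linarith) hη2).add
    (integrable_norm_rpow_div hN (s := s) (γ := γ - η) hη1 (by linarith))).div_const η
  have hm : Measurable (fun x : EuclideanSpace ℝ (Fin N) =>
      ‖x‖ ^ γ * Real.log ‖x‖ / (1 + ‖x‖ ^ ((N : ℝ) + 2 * s))) := by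
    fun_prop
  refine Integrable.mono' hi hm.aestronglyMeasurable (.of_forall fun x => ?_)
  have hd : 0 < 1 + ‖x‖ ^ ((N : ℝ) + 2 * s) := by positivity
  rw [norm_div, Real.norm_of_nonneg hd.le, Real.norm_eq_abs, Pi.add_apply, ← add_div,
    div_right_comm]
  gcongr
  exact abs_rpow_mul_log_le hη (norm_nonneg x)

/-- Away from its singularity the kernel `‖e - z‖^{-(N+2s)}` is dominated by the weight
`(1 + ‖z‖^{N+2s})⁻¹`. -/
lemma integrableOn_div_norm_sub_rpow (hs : 0 < s) {u : EuclideanSpace ℝ (Fin N) → ℝ}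
    (hu : Integrable (fun z => u z / (1 + ‖z‖ ^ ((N : ℝ) + 2 * s))))
    {e : EuclideanSpace ℝ (Fin N)} (he : ‖e‖ = 1) {ε : ℝ} (hε : 0 < ε) :
    IntegrableOn (fun z => u z / ‖e - z‖ ^ ((N : ℝ) + 2 * s)) (ball e ε)ᶜ := by
  set p : ℝ := (N : ℝ) + 2 * s with hp
  have hp0 : 0 < p := by positivity
  have hm : AEStronglyMeasurable (fun z => u z / ‖e - z‖ ^ p) := by
    have h1 : AEStronglyMeasurable (fun z : EuclideanSpace ℝ (Fin N) =>
        (1 + ‖z‖ ^ p) / ‖e - z‖ ^ p) := by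
      have : Measurable (fun z : EuclideanSpace ℝ (Fin N) => (1 + ‖z‖ ^ p) / ‖e - z‖ ^ p) := by
        fun_prop
      exact this.aestronglyMeasurable
    refine (hu.1.mul h1).congr (.of_forall fun z => ?_)
    have hd : 0 < 1 + ‖z‖ ^ p := by positivity
    simp only [Pi.mul_apply]
    field_simp
  refine Integrable.mono' ((hu.norm.const_mul ((ε ^ p)⁻¹ + (ε⁻¹ + 1) ^ p)).integrableOn)
    hm.restrict ?_
  refine (ae_restrict_mem measurableSet_ball.compl).mono fun z hz => ?_
  have hz' : ε ≤ ‖e - z‖ := by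
    rw [← dist_eq_norm, dist_comm]
    simpa using hz
  have hd : 0 < 1 + ‖z‖ ^ p := by positivity
  have hk : 0 < ‖e - z‖ := hε.trans_le hz'
  have h1 : ‖z‖ ≤ (ε⁻¹ + 1) * ‖e - z‖ := by
    have : ‖z‖ ≤ ‖e‖ + ‖e - z‖ := by
      have := norm_sub_le e (e - z)
      simpa using this
    have h2 : 1 ≤ ε⁻¹ * ‖e - z‖ := by
      rw [inv_mul_eq_div, le_div_iff₀ hε]; linarith
    rw [he] at this
    linarith
  have h2 : 1 + ‖z‖ ^ p ≤ ((ε ^ p)⁻¹ + (ε⁻¹ + 1) ^ p) * ‖e - z‖ ^ p := by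
    rw [add_mul, ← Real.mul_rpow (by positivity) hk.le]
    gcongr
    rw [inv_mul_eq_div, le_div_iff₀ (by positivity), one_mul]
    gcongr
  rw [norm_div, norm_div, Real.norm_of_nonneg hd.le, Real.norm_of_nonneg (by positivity :
    0 ≤ ‖e - z‖ ^ p), div_le_iff₀ (by positivity), mul_assoc, mul_comm, mul_assoc,
    div_mul_eq_mul_div]
  rw [le_div_iff₀ hd]
  calc ‖u z‖ * (1 + ‖z‖ ^ p) ≤ ‖u z‖ * (((ε ^ p)⁻¹ + (ε⁻¹ + 1) ^ p) * ‖e - z‖ ^ p) := by gcongr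
    _ = _ := by ring

lemma exists_abs_rpow_sub_one_le (γ : ℝ) :
    ∃ C : ℝ, 0 ≤ C ∧ ∀ r ∈ Icc (1 : ℝ) 2, |r ^ γ - 1| ≤ C * (r - 1) := by
  refine ⟨|γ| * 2 ^ |γ - 1|, by positivity, fun r hr => ?_⟩
  have := (convex_Icc (1 : ℝ) 2).norm_image_sub_le_of_norm_hasDerivWithin_le
    (f := fun x : ℝ => x ^ γ) (f' := fun x : ℝ => γ * x ^ (γ - 1)) (C := |γ| * 2 ^ |γ - 1|)
    (x := 1) (y := r)
    (fun x hx => (Real.hasDerivAt_rpow_const (Or.inl (by linarith [hx.1]))).hasDerivWithinAt)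
    (fun x hx => ?_) (by simp) hr
  · simpa [abs_of_nonneg (sub_nonneg.2 hr.1)] using this
  · have hx0 : 0 < x := by linarith [hx.1]
    rw [norm_mul, Real.norm_eq_abs, Real.norm_of_nonneg (by positivity)]
    gcongr
    calc x ^ (γ - 1) ≤ x ^ |γ - 1| := Real.rpow_le_rpow_of_exponent_le hx.1 (le_abs_self _)
      _ ≤ 2 ^ |γ - 1| := Real.rpow_le_rpow hx0.le hx.2 (abs_nonneg _)

lemma integrableOn_ball_norm_sub_rpow (hN : 1 ≤ N) (hs1 : s < 1)
    (e : EuclideanSpace ℝ (Fin N)) :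
    IntegrableOn (fun w => ‖e - w‖ ^ (2 - ((N : ℝ) + 2 * s))) (ball e 1) := by
  have h0 : IntegrableOn (fun y : EuclideanSpace ℝ (Fin N) => ‖y‖ ^ (2 - ((N : ℝ) + 2 * s)))
      (ball 0 1) := by
    refine integrableOn_ball_of_norm_le_rpow (C := 1) (α := (N : ℝ) + 2 * s - 2) (by simpa)
      (by simp; linarith) (.of_forall fun x => ?_) ?_
    · rw [Real.norm_of_nonneg (by positivity), one_mul, neg_sub]
    · exact (Measurable.aestronglyMeasurable (by fun_prop))
  have := (Measure.measurePreserving_sub_left (volume : Measure (EuclideanSpace ℝ (Fin N))) e)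
    |>.integrableOn_comp_preimage (MeasurableEquiv.subLeft e).measurableEmbedding
      (f := fun y => ‖y‖ ^ (2 - ((N : ℝ) + 2 * s))) (s := ball 0 1)
  have hpre : (fun w => e - w) ⁻¹' ball 0 1 = ball e 1 := by
    ext w
    simp [dist_eq_norm, norm_sub_rev]
  rw [hpre] at this
  exact this.2 h0

/-- A radial function on the exterior of the unit ball which vanishes to second order on the unit
sphere is integrable against the kernel, because `s < 1`. -/
lemma integrableOn_exterior_div (hN : 1 ≤ N) (hs : 0 < s) (hs1 : s < 1) {G : ℝ → ℝ}
    (hG : Integrable (fun z : EuclideanSpace ℝ (Fin N) => G ‖z‖ / (1 + ‖z‖ ^ ((N : ℝ) + 2 * s))))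
    {C : ℝ} (hC : ∀ r ∈ Icc (1 : ℝ) 2, |G r| ≤ C * (r - 1) ^ 2)
    {e : EuclideanSpace ℝ (Fin N)} (he : ‖e‖ = 1) :
    IntegrableOn (fun w => G ‖w‖ / ‖e - w‖ ^ ((N : ℝ) + 2 * s)) {w | 1 < ‖w‖} := by
  have hms : MeasurableSet {w : EuclideanSpace ℝ (Fin N) | 1 < ‖w‖} :=
    measurableSet_lt measurable_const measurable_norm
  have hoff := integrableOn_div_norm_sub_rpow hs hG he zero_lt_one
  have hm : AEStronglyMeasurable (fun w : EuclideanSpace ℝ (Fin N) =>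
      G ‖w‖ / ‖e - w‖ ^ ((N : ℝ) + 2 * s)) := by
    have h1 : AEStronglyMeasurable (fun z : EuclideanSpace ℝ (Fin N) =>
        (1 + ‖z‖ ^ ((N : ℝ) + 2 * s)) / ‖e - z‖ ^ ((N : ℝ) + 2 * s)) :=
      Measurable.aestronglyMeasurable (by fun_prop)
    refine (hG.1.mul h1).congr (.of_forall fun z => ?_)
    have hd : 0 < 1 + ‖z‖ ^ ((N : ℝ) + 2 * s) := by positivity
    simp only [Pi.mul_apply]
    field_simp
  have hon : IntegrableOn (fun w => G ‖w‖ / ‖e - w‖ ^ ((N : ℝ) + 2 * s))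
      ({w | 1 < ‖w‖} ∩ ball e 1) := by
    refine Integrable.mono'
      (((integrableOn_ball_norm_sub_rpow hN hs1 e).mono_set inter_subset_right).const_mul C)
      hm.restrict ?_
    refine (ae_restrict_mem (hms.inter measurableSet_ball)).mono fun w hw => ?_
    have hw1 : 1 < ‖w‖ := hw.1
    have hw2 : ‖e - w‖ < 1 := by
      have := hw.2
      rwa [mem_ball, dist_comm, dist_eq_norm] at this
    have hle : ‖w‖ - 1 ≤ ‖e - w‖ := by
      have := norm_sub_norm_le w e
      rw [he, norm_sub_rev] at this
      exact this
    have hpos : 0 < ‖e - w‖ := by linarith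
    have hC0 : 0 ≤ C := by
      have := (abs_nonneg _).trans (hC 2 ⟨by norm_num, le_rfl⟩)
      norm_num at this
      exact this
    rw [norm_div, Real.norm_of_nonneg (by positivity : 0 ≤ ‖e - w‖ ^ ((N : ℝ) + 2 * s)),
      Real.rpow_sub hpos, ← mul_div_assoc]
    gcongr
    rw [Real.norm_eq_abs, Real.rpow_two]
    refine (hC _ ⟨hw1.le, by linarith⟩).trans ?_
    gcongr
  have hoff' := hoff.mono_set (s := {w | 1 < ‖w‖} ∩ (ball e 1)ᶜ) inter_subset_right
  refine (hon.union hoff').mono_set ?_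
  rw [inter_union_compl]

/-! ### Folding the truncated integral by inversion -/

lemma norm_inversion (w : EuclideanSpace ℝ (Fin N)) :
    ‖EuclideanGeometry.inversion (0 : EuclideanSpace ℝ (Fin N)) 1 w‖ = ‖w‖⁻¹ := by
  have := EuclideanGeometry.dist_inversion_center (0 : EuclideanSpace ℝ (Fin N)) w 1
  simpa using this

lemma norm_sub_inversion {e w : EuclideanSpace ℝ (Fin N)} (he : ‖e‖ = 1) (hw : w ≠ 0) :
    ‖e - EuclideanGeometry.inversion (0 : EuclideanSpace ℝ (Fin N)) 1 w‖ = ‖e - w‖ / ‖w‖ := by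
  have he0 : e ≠ 0 := by
    rintro rfl
    simp at he
  have h1 := EuclideanGeometry.dist_inversion_inversion he0 hw 1
  have h2 : EuclideanGeometry.inversion (0 : EuclideanSpace ℝ (Fin N)) 1 e = e :=
    EuclideanGeometry.inversion_of_mem_sphere (by simpa using he)
  simp only [h2, dist_eq_norm, sub_zero, he] at h1
  rw [h1]
  ring

lemma abs_det_fderiv_inversion (w : EuclideanSpace ℝ (Fin N)) :
    |(((1 / dist w 0) ^ 2 • ((ℝ ∙ (w - 0))ᗮ.reflection :
      EuclideanSpace ℝ (Fin N) →L[ℝ] EuclideanSpace ℝ (Fin N)))).det| = (‖w‖ ^ (2 * N))⁻¹ := by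
  have h1 : LinearMap.det ((ℝ ∙ (w - 0))ᗮ.reflection.toLinearMap) = _ :=
    Submodule.det_reflection _
  have h2 : ((((1 / dist w 0) ^ 2 • ((ℝ ∙ (w - 0))ᗮ.reflection :
      EuclideanSpace ℝ (Fin N) →L[ℝ] EuclideanSpace ℝ (Fin N)))).det) =
      LinearMap.det ((1 / dist w 0) ^ 2 • (ℝ ∙ (w - 0))ᗮ.reflection.toLinearMap) := rfl
  rw [h2, LinearMap.det_smul, h1, abs_mul, abs_pow, abs_pow, abs_pow, abs_neg, abs_one,
    one_pow, mul_one]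
  simp [pow_mul]

lemma setIntegral_image_inversion {S : Set (EuclideanSpace ℝ (Fin N))} (hS : MeasurableSet S)
    (h0 : (0 : EuclideanSpace ℝ (Fin N)) ∉ S) (g : EuclideanSpace ℝ (Fin N) → ℝ) :
    (IntegrableOn g (EuclideanGeometry.inversion 0 1 '' S) ↔
      IntegrableOn (fun w => (‖w‖ ^ (2 * N))⁻¹ * g (EuclideanGeometry.inversion 0 1 w)) S) ∧
    ∫ z in EuclideanGeometry.inversion 0 1 '' S, g z =
      ∫ w in S, (‖w‖ ^ (2 * N))⁻¹ * g (EuclideanGeometry.inversion 0 1 w) := by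
  have hd : ∀ w ∈ S, HasFDerivWithinAt
      (EuclideanGeometry.inversion (0 : EuclideanSpace ℝ (Fin N)) 1) _ S w := fun w hw =>
    (EuclideanGeometry.hasFDerivAt_inversion (R := 1)
      (show w ≠ 0 from fun h => h0 (h ▸ hw))).hasFDerivWithinAt
  have hinj : InjOn (EuclideanGeometry.inversion (0 : EuclideanSpace ℝ (Fin N)) 1) S :=
    (EuclideanGeometry.inversion_injective 0 one_ne_zero).injOn
  have h1 := integrableOn_image_iff_integrableOn_abs_det_fderiv_smul volume hS hd hinj g
  have h2 := integral_image_eq_integral_abs_det_fderiv_smul volume hS hd hinj g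
  simp only [abs_det_fderiv_inversion, smul_eq_mul] at h1 h2
  exact ⟨h1, h2⟩

lemma integrableOn_sub_div (hN : 1 ≤ N) (hs : 0 < s) {u : EuclideanSpace ℝ (Fin N) → ℝ}
    (hu : Integrable (fun z => u z / (1 + ‖z‖ ^ ((N : ℝ) + 2 * s)))) (c : ℝ)
    {e : EuclideanSpace ℝ (Fin N)} (he : ‖e‖ = 1) {ε : ℝ} (hε : 0 < ε) :
    IntegrableOn (fun z => (c - u z) / ‖e - z‖ ^ ((N : ℝ) + 2 * s)) (ball e ε)ᶜ := by
  have h1 := (integrable_norm_rpow_div hN (s := s) (γ := 0)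
    (by simp; omega) (by linarith)).const_mul c
  refine integrableOn_div_norm_sub_rpow hs ((h1.sub hu).congr (.of_forall fun z => ?_)) he hε
  simp only [Pi.sub_apply, Real.rpow_zero]
  ring

/-- Splitting the truncated integral along the unit sphere and folding the inner part onto the
outer one by inversion. The truncation is not invariant under inversion; the second integral
is the defect. -/
lemma setIntegral_compl_ball_eq (hN : 1 ≤ N) (hs : 0 < s) {f G : ℝ → ℝ}
    (hf : Integrable (fun z : EuclideanSpace ℝ (Fin N) => f ‖z‖ / (1 + ‖z‖ ^ ((N : ℝ) + 2 * s))))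
    (hG : ∀ r, 1 < r → G r = (f 1 - f r) + (f 1 - f r⁻¹) * r ^ (2 * s - N))
    {e : EuclideanSpace ℝ (Fin N)} (he : ‖e‖ = 1) {ε : ℝ} (hε : 0 < ε) :
    ∫ z in (ball e ε)ᶜ, (f 1 - f ‖z‖) / ‖e - z‖ ^ ((N : ℝ) + 2 * s) =
      (∫ w in {w | 1 < ‖w‖ ∧ ε * ‖w‖ ≤ ‖e - w‖}, G ‖w‖ / ‖e - w‖ ^ ((N : ℝ) + 2 * s)) +
      ∫ w in {w | 1 < ‖w‖ ∧ ε ≤ ‖e - w‖ ∧ ‖e - w‖ < ε * ‖w‖},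
        (f 1 - f ‖w‖) / ‖e - w‖ ^ ((N : ℝ) + 2 * s) := by
  have : Nonempty (Fin N) := ⟨⟨0, hN⟩⟩
  set p : ℝ := (N : ℝ) + 2 * s with hp
  set ι := EuclideanGeometry.inversion (0 : EuclideanSpace ℝ (Fin N)) 1 with hι
  set h : EuclideanSpace ℝ (Fin N) → ℝ := fun z => (f 1 - f ‖z‖) / ‖e - z‖ ^ p with hh
  have hint : IntegrableOn h (ball e ε)ᶜ := integrableOn_sub_div hN hs hf (f 1) he hε
  have hE : MeasurableSet {w : EuclideanSpace ℝ (Fin N) | 1 < ‖w‖} :=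
    measurableSet_lt measurable_const measurable_norm
  set S : Set (EuclideanSpace ℝ (Fin N)) := {w | 1 < ‖w‖ ∧ ε * ‖w‖ ≤ ‖e - w‖} with hSdef
  set R : Set (EuclideanSpace ℝ (Fin N)) := {w | 1 < ‖w‖ ∧ ε ≤ ‖e - w‖ ∧ ‖e - w‖ < ε * ‖w‖}
    with hRdef
  have hE1 : MeasurableSet {w : EuclideanSpace ℝ (Fin N) | ε * ‖w‖ ≤ ‖e - w‖} :=
    measurableSet_le (by fun_prop) (by fun_prop)
  have hE2 : MeasurableSet {w : EuclideanSpace ℝ (Fin N) | ε ≤ ‖e - w‖} :=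
    measurableSet_le (by fun_prop) (by fun_prop)
  have hE3 : MeasurableSet {w : EuclideanSpace ℝ (Fin N) | ‖e - w‖ < ε * ‖w‖} :=
    measurableSet_lt (by fun_prop) (by fun_prop)
  have hS : MeasurableSet S := hE.inter hE1
  have hR : MeasurableSet R := hE.inter (hE2.inter hE3)
  have hmem : ∀ z, z ∈ (ball e ε)ᶜ ↔ ε ≤ ‖e - z‖ := fun z => by
    simp [dist_eq_norm, norm_sub_rev]
  have hS0 : (0 : EuclideanSpace ℝ (Fin N)) ∉ S := fun h => by
    have := h.1
    simp at this
    linarith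
  have hA : (ball e ε)ᶜ ∩ {w | 1 < ‖w‖} = S ∪ R := by
    ext w
    rw [mem_inter_iff, hmem]
    simp only [hSdef, hRdef, mem_ofPred_eq, mem_union]
    constructor
    · rintro ⟨h1, h2⟩
      rcases le_or_gt (ε * ‖w‖) ‖e - w‖ with h3 | h3
      · exact Or.inl ⟨h2, h3⟩
      · exact Or.inr ⟨h2, h1, h3⟩
    · rintro (⟨h1, h2⟩ | ⟨h1, h2, -⟩)
      · exact ⟨by nlinarith, h1⟩
      · exact ⟨h2, h1⟩
  have hdisj : Disjoint S R := by
    rw [Set.disjoint_left]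
    rintro w ⟨-, h1⟩ ⟨-, -, h2⟩
    linarith
  -- the inversion misses the origin and maps the open exterior to the open ball, so the two sets
  -- agree off the null set formed by the origin and the unit sphere
  have hB : ((ball e ε)ᶜ \ {w | 1 < ‖w‖} : Set (EuclideanSpace ℝ (Fin N))) =ᵐ[volume] ι '' S := by
    have hn : volume ({0} ∪ sphere (0 : EuclideanSpace ℝ (Fin N)) 1) = 0 :=
      measure_union_null (measure_singleton _) (Measure.addHaar_sphere _ _ _)
    have hsub : ∀ z, z ∉ ({0} ∪ sphere (0 : EuclideanSpace ℝ (Fin N)) 1 :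
        Set (EuclideanSpace ℝ (Fin N))) →
        (z ∈ ((ball e ε)ᶜ \ {w | 1 < ‖w‖} : Set (EuclideanSpace ℝ (Fin N))) ↔ z ∈ ι '' S) := by
      intro z hz
      simp only [mem_union, mem_singleton_iff, mem_sphere, dist_zero_right, not_or] at hz
      have hz0 : 0 < ‖z‖ := norm_pos_iff.2 hz.1
      have hinv : ι (ι z) = z := EuclideanGeometry.inversion_inversion 0 one_ne_zero z
      have himg : z ∈ ι '' S ↔ ι z ∈ S := by
        constructor
        · rintro ⟨w, hw, rfl⟩
          rwa [hι, EuclideanGeometry.inversion_inversion 0 one_ne_zero]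
        · intro h
          exact ⟨ι z, h, hinv⟩
      rw [himg, Set.mem_sdiff, hmem]
      simp only [hSdef, mem_ofPred_eq, norm_inversion, hι, norm_sub_inversion he hz.1, not_lt]
      rw [one_lt_inv₀ hz0, ← div_eq_mul_inv, div_le_div_iff_of_pos_right hz0, and_comm]
      exact and_congr_left fun _ => ⟨fun h => lt_of_le_of_ne h hz.2, le_of_lt⟩
    refine eventuallyEq_set.2 ?_
    filter_upwards [compl_mem_ae_iff.2 hn] with z hz
    exact hsub z hz
  have h1 : ∫ z in (ball e ε)ᶜ, h z = (∫ z in S, h z) + (∫ z in R, h z) + ∫ z in ι '' S, h z := by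
    rw [← integral_inter_add_sdiff hE hint, hA, setIntegral_congr_set hB,
      setIntegral_union hdisj hR]
    · exact hint.mono_set (subset_union_left.trans (hA ▸ inter_subset_left))
    · exact hint.mono_set (subset_union_right.trans (hA ▸ inter_subset_left))
  obtain ⟨hi1, hi2⟩ := setIntegral_image_inversion hS hS0 h
  have hiS : IntegrableOn h S := hint.mono_set (subset_union_left.trans (hA ▸ inter_subset_left))
  have hiB : IntegrableOn h (ι '' S) := by
    rw [← integrableOn_congr_set_ae hB]
    exact hint.mono_set sdiff_subset
  rw [h1, hi2, add_right_comm, ← integral_add hiS (hi1.1 hiB)]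
  congr 1
  refine setIntegral_congr_fun hS fun w hw => ?_
  have hw1 : 1 < ‖w‖ := hw.1
  have hw0 : 0 < ‖w‖ := by linarith
  have hd : 0 < ‖e - w‖ := lt_of_lt_of_le (by positivity) hw.2
  have hne : w ≠ 0 := norm_pos_iff.1 hw0
  simp only [hh, norm_inversion, norm_sub_inversion he hne, hG _ hw1]
  rw [Real.div_rpow hd.le hw0.le, add_div, div_div_eq_mul_div]
  congr 1
  have : ‖w‖ ^ (2 * s - N) = (‖w‖ ^ (2 * N))⁻¹ * ‖w‖ ^ p := by
    rw [← Real.rpow_natCast, ← Real.rpow_neg hw0.le, ← Real.rpow_add hw0, hp]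
    push_cast
    ring_nf
  rw [this]
  ring

lemma one_add_pow_le {t : ℝ} (h0 : 0 ≤ t) (h1 : t ≤ 1) (n : ℕ) :
    (1 + t) ^ n ≤ 1 + (2 ^ n - 1) * t := by
  induction n with
  | zero => simp
  | succ n ih =>
    have : (1 : ℝ) ≤ 2 ^ n := one_le_pow₀ (by norm_num)
    calc (1 + t) ^ (n + 1) = (1 + t) ^ n * (1 + t) := pow_succ _ _
      _ ≤ (1 + (2 ^ n - 1) * t) * (1 + t) := by gcongr
      _ ≤ 1 + (2 ^ (n + 1) - 1) * t := by
        rw [pow_succ]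
        nlinarith [mul_nonneg (mul_nonneg (sub_nonneg.2 this) h0) (sub_nonneg.2 h1)]

/-- The shell on which the truncation fails to be invariant under inversion has thickness of order
`ε²`, so that its contribution is of order `ε ^ (2 - 2s)`. -/
lemma norm_setIntegral_shell_le (hN : 1 ≤ N) (hs : 0 < s) {f : ℝ → ℝ} {C : ℝ}
    (hC : ∀ r ∈ Icc (1 : ℝ) 2, |f r - f 1| ≤ C * (r - 1))
    {e : EuclideanSpace ℝ (Fin N)} (he : ‖e‖ = 1) {ε : ℝ} (hε : 0 < ε) (hε1 : ε ≤ 1 / 2) :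
    ‖∫ w in {w | 1 < ‖w‖ ∧ ε ≤ ‖e - w‖ ∧ ‖e - w‖ < ε * ‖w‖},
        (f 1 - f ‖w‖) / ‖e - w‖ ^ ((N : ℝ) + 2 * s)‖ ≤
      C * 2 ^ (N + 1) * volume.real (ball (0 : EuclideanSpace ℝ (Fin N)) 1) *
        ε ^ (2 - 2 * s) := by
  have : Nonempty (Fin N) := ⟨⟨0, hN⟩⟩
  set p : ℝ := (N : ℝ) + 2 * s with hp
  have hN' : (1 : ℝ) ≤ N := by exact_mod_cast hN
  set R : Set (EuclideanSpace ℝ (Fin N)) := {w | 1 < ‖w‖ ∧ ε ≤ ‖e - w‖ ∧ ‖e - w‖ < ε * ‖w‖}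
    with hRdef
  have hC0 : 0 ≤ C := by
    have := (abs_nonneg _).trans (hC 2 ⟨by norm_num, le_rfl⟩)
    norm_num at this
    exact this
  have hle : ∀ w : EuclideanSpace ℝ (Fin N), ‖w‖ ≤ 1 + ‖e - w‖ := fun w => by
    have := norm_sub_norm_le w e
    rw [he, norm_sub_rev] at this
    linarith
  have hd : ∀ w ∈ R, ‖e - w‖ < ε * (1 + 2 * ε) := by
    rintro w ⟨-, -, h⟩
    have h1 : ‖e - w‖ < ε * (1 + ‖e - w‖) := h.trans_le (by gcongr; exact hle w)
    by_contra! hcon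
    nlinarith [mul_nonneg (sub_nonneg.2 hcon) (by linarith : 0 ≤ 1 - ε),
      mul_nonneg (sq_nonneg ε) (by linarith : 0 ≤ 1 - 2 * ε)]
  have hsub : R ⊆ ball e (ε * (1 + 2 * ε)) \ ball e ε := by
    intro w hw
    refine ⟨?_, ?_⟩
    · rw [mem_ball, dist_comm, dist_eq_norm]
      exact hd w hw
    · rw [mem_ball, dist_comm, dist_eq_norm, not_lt]
      exact hw.2.1
  have hvb : ∀ r : ℝ, 0 ≤ r → volume.real (ball e r) =
      r ^ N * volume.real (ball (0 : EuclideanSpace ℝ (Fin N)) 1) := fun r hr => by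
    rw [measureReal_def, Measure.addHaar_ball _ _ hr, ENNReal.toReal_mul, ENNReal.toReal_ofReal
      (by positivity), finrank_euclideanSpace, Fintype.card_fin, measureReal_def]
  have hvol : volume.real R ≤
      ε ^ N * (2 ^ N * (2 * ε)) * volume.real (ball (0 : EuclideanSpace ℝ (Fin N)) 1) := by
    calc volume.real R ≤ volume.real (ball e (ε * (1 + 2 * ε)) \ ball e ε) :=
          measureReal_mono hsub (measure_ne_top_of_subset sdiff_subset measure_ball_lt_top.ne)
      _ = volume.real (ball e (ε * (1 + 2 * ε))) - volume.real (ball e ε) :=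
          measureReal_sdiff (ball_subset_ball (by nlinarith)) measurableSet_ball
      _ = ε ^ N * ((1 + 2 * ε) ^ N - 1) *
          volume.real (ball (0 : EuclideanSpace ℝ (Fin N)) 1) := by
          rw [hvb _ (by positivity), hvb _ hε.le, mul_pow]
          ring
      _ ≤ _ := by
          gcongr
          linarith [one_add_pow_le (by linarith : 0 ≤ 2 * ε) (by linarith) N]
  have hbd : ∀ w ∈ R, ‖(f 1 - f ‖w‖) / ‖e - w‖ ^ p‖ ≤ C * ε ^ (1 - p) := by
    intro w hw
    have hpos : 0 < ‖e - w‖ := hε.trans_le hw.2.1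
    have hw2 : ‖w‖ ≤ 2 := by
      have := hd w hw
      have := hle w
      nlinarith
    rw [norm_div, Real.norm_of_nonneg (by positivity : 0 ≤ ‖e - w‖ ^ p), Real.norm_eq_abs,
      abs_sub_comm]
    calc |f ‖w‖ - f 1| / ‖e - w‖ ^ p ≤ C * ‖e - w‖ / ‖e - w‖ ^ p := by
          gcongr
          refine (hC _ ⟨hw.1.le, hw2⟩).trans ?_
          gcongr
          linarith [hle w]
      _ = C * ‖e - w‖ ^ (1 - p) := by
          rw [Real.rpow_sub hpos, Real.rpow_one, mul_div_assoc]
      _ ≤ C * ε ^ (1 - p) := by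
          exact mul_le_mul_of_nonneg_left
            (Real.rpow_le_rpow_of_nonpos hε hw.2.1 (by linarith)) hC0
  have hfin : volume R < ⊤ :=
    (measure_mono (hsub.trans sdiff_subset)).trans_lt measure_ball_lt_top
  refine (norm_setIntegral_le_of_norm_le_const hfin hbd).trans ?_
  calc C * ε ^ (1 - p) * volume.real R ≤ C * ε ^ (1 - p) * (ε ^ N * (2 ^ N * (2 * ε)) *
        volume.real (ball (0 : EuclideanSpace ℝ (Fin N)) 1)) := by gcongr
    _ = _ := by
      have : ε ^ (2 - 2 * s) = ε ^ (1 - p) * (ε ^ N * ε) := by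
        rw [← pow_succ, ← Real.rpow_natCast ε (N + 1), ← Real.rpow_add hε, hp]
        push_cast
        ring_nf
      rw [this]
      ring

/-- The principal value of a radial profile `f` at a unit vector, as an absolutely convergent
integral over the exterior of the unit ball. -/
theorem tendsto_setIntegral_compl_ball (hN : 1 ≤ N) (hs : 0 < s) (hs1 : s < 1) {f G : ℝ → ℝ}
    (hf : Integrable (fun z : EuclideanSpace ℝ (Fin N) => f ‖z‖ / (1 + ‖z‖ ^ ((N : ℝ) + 2 * s))))
    (hG : ∀ r, 1 < r → G r = (f 1 - f r) + (f 1 - f r⁻¹) * r ^ (2 * s - N))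
    {C : ℝ} (hC : ∀ r ∈ Icc (1 : ℝ) 2, |f r - f 1| ≤ C * (r - 1))
    {e : EuclideanSpace ℝ (Fin N)} (he : ‖e‖ = 1)
    (hGi : IntegrableOn (fun w => G ‖w‖ / ‖e - w‖ ^ ((N : ℝ) + 2 * s)) {w | 1 < ‖w‖}) :
    Tendsto (fun ε : ℝ => ∫ z in (ball e ε)ᶜ, (f 1 - f ‖z‖) / ‖e - z‖ ^ ((N : ℝ) + 2 * s))
      (𝓝[>] 0) (𝓝 (∫ w in {w | 1 < ‖w‖}, G ‖w‖ / ‖e - w‖ ^ ((N : ℝ) + 2 * s))) := by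
  have hE : MeasurableSet {w : EuclideanSpace ℝ (Fin N) | 1 < ‖w‖} :=
    measurableSet_lt measurable_const measurable_norm
  have hM : ∀ ε : ℝ, MeasurableSet {w : EuclideanSpace ℝ (Fin N) | ε * ‖w‖ ≤ ‖e - w‖} :=
    fun ε => measurableSet_le (by fun_prop) (by fun_prop)
  have hmain : Tendsto (fun ε : ℝ => ∫ w in {w | 1 < ‖w‖ ∧ ε * ‖w‖ ≤ ‖e - w‖},
      G ‖w‖ / ‖e - w‖ ^ ((N : ℝ) + 2 * s)) (𝓝[>] 0)
      (𝓝 (∫ w in {w | 1 < ‖w‖}, G ‖w‖ / ‖e - w‖ ^ ((N : ℝ) + 2 * s))) := by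
    have heq : ∀ ε : ℝ, ∫ w in {w | 1 < ‖w‖ ∧ ε * ‖w‖ ≤ ‖e - w‖},
        G ‖w‖ / ‖e - w‖ ^ ((N : ℝ) + 2 * s) = ∫ w in {w | 1 < ‖w‖},
        {w | ε * ‖w‖ ≤ ‖e - w‖}.indicator (fun w => G ‖w‖ / ‖e - w‖ ^ ((N : ℝ) + 2 * s)) w :=
      fun ε => (setIntegral_indicator (hM ε)).symm
    simp only [heq]
    refine tendsto_integral_filter_of_dominated_convergence
      (fun w => ‖G ‖w‖ / ‖e - w‖ ^ ((N : ℝ) + 2 * s)‖) (.of_forall fun ε =>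
        hGi.1.indicator (hM ε)) (.of_forall fun ε => .of_forall fun w =>
        norm_indicator_le_norm_self _ _) hGi.norm ?_
    refine (ae_restrict_mem hE).mono fun w hw => ?_
    have hw1 : 1 < ‖w‖ := hw
    have hpos : 0 < ‖e - w‖ := by
      rw [norm_pos_iff, sub_ne_zero]
      rintro rfl
      linarith
    refine tendsto_const_nhds.congr' ?_
    have hlt : ∀ᶠ ε : ℝ in 𝓝[>] 0, ε < ‖e - w‖ / ‖w‖ :=
      (eventually_lt_nhds (by positivity)).filter_mono nhdsWithin_le_nhds
    filter_upwards [hlt] with ε h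
    rw [indicator_of_mem]
    rw [lt_div_iff₀ (by linarith)] at h
    exact h.le
  have hshell : Tendsto (fun ε : ℝ => ∫ w in {w | 1 < ‖w‖ ∧ ε ≤ ‖e - w‖ ∧ ‖e - w‖ < ε * ‖w‖},
        (f 1 - f ‖w‖) / ‖e - w‖ ^ ((N : ℝ) + 2 * s)) (𝓝[>] 0) (𝓝 0) := by
    have hlim : Tendsto (fun ε : ℝ => C * 2 ^ (N + 1) *
        volume.real (ball (0 : EuclideanSpace ℝ (Fin N)) 1) * ε ^ (2 - 2 * s)) (𝓝[>] 0) (𝓝 0) := by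
      have : Tendsto (fun ε : ℝ => ε ^ (2 - 2 * s)) (𝓝[>] 0) (𝓝 0) := by
        have h := (Real.continuousAt_rpow_const 0 (2 - 2 * s) (Or.inr (by linarith))).tendsto
        rw [Real.zero_rpow (by linarith)] at h
        exact h.mono_left nhdsWithin_le_nhds
      simpa using this.const_mul _
    refine squeeze_zero_norm' ?_ hlim
    filter_upwards [Ioc_mem_nhdsGT (show (0 : ℝ) < 1 / 2 by norm_num)] with ε hε
    exact norm_setIntegral_shell_le hN hs hC he hε.1 hε.2
  have := hmain.add hshell
  rw [add_zero] at this
  refine this.congr' ?_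
  filter_upwards [self_mem_nhdsWithin] with ε hε
  exact (setIntegral_compl_ball_eq hN hs hf hG he hε).symm

/-! ### The fractional Laplacian of powers and of logarithmic profiles -/

lemma exists_linearIsometryEquiv_apply_eq {e x : EuclideanSpace ℝ (Fin N)} (he : ‖e‖ = 1)
    (hx : x ≠ 0) :
    ∃ R : EuclideanSpace ℝ (Fin N) ≃ₗᵢ[ℝ] EuclideanSpace ℝ (Fin N), ‖x‖ • R e = x := by
  have hx0 : ‖x‖ ≠ 0 := norm_ne_zero_iff.2 hx
  have h : ‖e‖ = ‖‖x‖⁻¹ • x‖ := by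
    rw [he, norm_smul, norm_inv, norm_norm, inv_mul_cancel₀ hx0]
  exact ⟨_, by rw [Submodule.reflection_sub h, smul_smul, mul_inv_cancel₀ hx0, one_smul]⟩

lemma integrable_and_integral_comp_smul_isometry {ρ : ℝ} (hρ : 0 < ρ)
    (R : EuclideanSpace ℝ (Fin N) ≃ₗᵢ[ℝ] EuclideanSpace ℝ (Fin N))
    (F : EuclideanSpace ℝ (Fin N) → ℝ) :
    (Integrable (fun w => F (ρ • R w)) ↔ Integrable F) ∧
      ∫ w, F (ρ • R w) = (ρ ^ N)⁻¹ * ∫ z, F z := by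
  constructor
  · rw [← integrable_comp_smul_iff volume F hρ.ne']
    exact R.measurePreserving.integrable_comp_emb R.toMeasurableEquiv.measurableEmbedding
      (g := fun z => F (ρ • z))
  · rw [R.measurePreserving.integral_comp R.toMeasurableEquiv.measurableEmbedding
      (fun z => F (ρ • z)), Measure.integral_comp_smul]
    simp [abs_of_pos (pow_pos hρ N)]

/-- The truncated integrals of the fractional Laplacian scale like a homogeneous function of
degree `-2s`, and commute with linear isometries. -/
lemma truncated_comp_smul_isometry {ρ : ℝ} (hρ : 0 < ρ)
    (R : EuclideanSpace ℝ (Fin N) ≃ₗᵢ[ℝ] EuclideanSpace ℝ (Fin N))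
    (u : EuclideanSpace ℝ (Fin N) → ℝ) (e : EuclideanSpace ℝ (Fin N)) (ε : ℝ) :
    (IntegrableOn (fun w => (u (ρ • R e) - u (ρ • R w)) / ‖e - w‖ ^ ((N : ℝ) + 2 * s))
        (ball e (ε / ρ))ᶜ →
      IntegrableOn (fun z => (u (ρ • R e) - u z) / ‖ρ • R e - z‖ ^ ((N : ℝ) + 2 * s))
        (ball (ρ • R e) ε)ᶜ) ∧
    ∫ z in (ball (ρ • R e) ε)ᶜ, (u (ρ • R e) - u z) / ‖ρ • R e - z‖ ^ ((N : ℝ) + 2 * s) =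
      ρ ^ (-(2 * s)) * ∫ w in (ball e (ε / ρ))ᶜ,
        (u (ρ • R e) - u (ρ • R w)) / ‖e - w‖ ^ ((N : ℝ) + 2 * s) := by
  set F : EuclideanSpace ℝ (Fin N) → ℝ := (ball (ρ • R e) ε)ᶜ.indicator
    (fun z => (u (ρ • R e) - u z) / ‖ρ • R e - z‖ ^ ((N : ℝ) + 2 * s)) with hF
  have hmem : ∀ w, ρ • R w ∈ (ball (ρ • R e) ε)ᶜ ↔ w ∈ (ball e (ε / ρ))ᶜ := fun w => by
    rw [mem_compl_iff, mem_compl_iff, mem_ball, mem_ball, dist_smul₀, R.dist_map,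
      Real.norm_of_nonneg hρ.le, lt_div_iff₀ hρ, mul_comm]
  have hcomp : ∀ w, F (ρ • R w) = (ρ ^ ((N : ℝ) + 2 * s))⁻¹ * (ball e (ε / ρ))ᶜ.indicator
      (fun w => (u (ρ • R e) - u (ρ • R w)) / ‖e - w‖ ^ ((N : ℝ) + 2 * s)) w := fun w => by
    by_cases h : w ∈ (ball e (ε / ρ))ᶜ
    · rw [hF, indicator_of_mem ((hmem w).2 h), indicator_of_mem h, ← smul_sub, ← map_sub,
        norm_smul, R.norm_map, Real.norm_of_nonneg hρ.le,
        Real.mul_rpow hρ.le (norm_nonneg _)]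
      rw [div_mul_eq_div_div_swap, div_eq_inv_mul _ (ρ ^ _)]
    · rw [hF, indicator_of_notMem (fun h' => h ((hmem w).1 h')), indicator_of_notMem h, mul_zero]
  obtain ⟨h1, h2⟩ := integrable_and_integral_comp_smul_isometry hρ R F
  constructor
  · intro h
    rw [← integrable_indicator_iff measurableSet_ball.compl, ← hF, ← h1]
    simp only [hcomp]
    exact (h.integrable_indicator measurableSet_ball.compl).const_mul _
  · rw [← integral_indicator measurableSet_ball.compl, ← hF]
    simp only [hcomp] at h2
    rw [integral_const_mul, integral_indicator measurableSet_ball.compl] at h2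
    have hpos : (ρ ^ N) ≠ 0 := (pow_pos hρ N).ne'
    rw [eq_comm, inv_mul_eq_iff_eq_mul₀ hpos] at h2
    rw [h2, ← mul_assoc]
    congr 1
    rw [Real.rpow_neg hρ.le, Real.rpow_add hρ, Real.rpow_natCast]
    field_simp

lemma HasFracLaplacianAt.of_comp_smul_isometry {ρ : ℝ} (hρ : 0 < ρ)
    (R : EuclideanSpace ℝ (Fin N) ≃ₗᵢ[ℝ] EuclideanSpace ℝ (Fin N))
    {u : EuclideanSpace ℝ (Fin N) → ℝ} {e : EuclideanSpace ℝ (Fin N)} {l : ℝ}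
    (h : HasFracLaplacianAt s (fun w => u (ρ • R w)) e l) :
    HasFracLaplacianAt s u (ρ • R e) (ρ ^ (-(2 * s)) * l) := by
  refine ⟨fun ε hε => (truncated_comp_smul_isometry hρ R u e ε).1 (h.1 _ (by positivity)), ?_⟩
  have hdiv : Tendsto (fun ε : ℝ => ε / ρ) (𝓝[>] 0) (𝓝[>] 0) := by
    refine tendsto_nhdsWithin_iff.2 ⟨?_, ?_⟩
    · have : Tendsto (fun ε : ℝ => ε / ρ) (𝓝 0) (𝓝 (0 / ρ)) := tendsto_id.div_const ρ
      rw [zero_div] at this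
      exact this.mono_left nhdsWithin_le_nhds
    · filter_upwards [self_mem_nhdsWithin] with ε hε
      exact div_pos hε hρ
  refine ((h.2.comp hdiv).const_mul (ρ ^ (-(2 * s)))).congr fun ε => ?_
  rw [(truncated_comp_smul_isometry hρ R u e ε).2]
  simp only [Function.comp]
  ring

lemma HasFracLaplacianAt.linear_combination {u v : EuclideanSpace ℝ (Fin N) → ℝ}
    {x : EuclideanSpace ℝ (Fin N)} {l m : ℝ} (hu : HasFracLaplacianAt s u x l)
    (hv : HasFracLaplacianAt s v x m) (a b : ℝ) :
    HasFracLaplacianAt s (fun z => a * u z + b * v z) x (a * l + b * m) := by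
  have heq : ∀ z, (a * u x + b * v x - (a * u z + b * v z)) / ‖x - z‖ ^ ((N : ℝ) + 2 * s) =
      a * ((u x - u z) / ‖x - z‖ ^ ((N : ℝ) + 2 * s)) +
      b * ((v x - v z) / ‖x - z‖ ^ ((N : ℝ) + 2 * s)) := fun z => by ring
  refine ⟨fun ε hε => ?_, ?_⟩
  · simp only [heq]
    exact ((hu.1 ε hε).const_mul a).add ((hv.1 ε hε).const_mul b)
  · refine ((hu.2.const_mul a).add (hv.2.const_mul b)).congr' ?_
    filter_upwards [self_mem_nhdsWithin] with ε hε
    simp only [heq]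
    rw [integral_add ((hu.1 ε hε).const_mul a) ((hv.1 ε hε).const_mul b), integral_const_mul,
      integral_const_mul]
    ring

lemma HasFracLaplacianAt.unique {u : EuclideanSpace ℝ (Fin N) → ℝ}
    {x : EuclideanSpace ℝ (Fin N)} {l m : ℝ} (hl : HasFracLaplacianAt s u x l)
    (hm : HasFracLaplacianAt s u x m) : l = m :=
  tendsto_nhds_unique hl.2 hm.2

/-- The integral of a radial function over the exterior of the unit ball against the kernel
centred at `e`. -/
noncomputable def extIntegral (s : ℝ) (e : EuclideanSpace ℝ (Fin N)) (G : ℝ → ℝ) : ℝ :=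
  ∫ w in {w | 1 < ‖w‖}, G ‖w‖ / ‖e - w‖ ^ ((N : ℝ) + 2 * s)

/-- What remains of the profile `r ^ τ` after folding the unit ball onto its exterior by
inversion; it factors as `(1 - r ^ τ) * (1 - r ^ (2s - N - τ))`. -/
noncomputable def powBracket (N : ℕ) (s τ r : ℝ) : ℝ :=
  1 + r ^ (2 * s - N) - r ^ τ - r ^ (2 * s - N - τ)

/-- What remains of the profile `r ^ τ * log r` after folding the unit ball onto its exterior by
inversion. -/
noncomputable def logBracket (N : ℕ) (s τ r : ℝ) : ℝ :=
  r ^ (2 * s - N - τ) * Real.log r - r ^ τ * Real.log r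

/-- The factor `c(τ)` in `(-Δ)^s |x|^τ = c(τ) |x|^(τ - 2s)`, computed at the unit vector `e`. -/
noncomputable def symbol (s : ℝ) (e : EuclideanSpace ℝ (Fin N)) (τ : ℝ) : ℝ :=
  normConst N s * extIntegral s e (powBracket N s τ)

lemma powBracket_eq_mul {τ r : ℝ} (hr : 0 < r) :
    powBracket N s τ r = (1 - r ^ τ) * (1 - r ^ (2 * s - N - τ)) := by
  have : r ^ (2 * s - N) = r ^ τ * r ^ (2 * s - N - τ) := by
    rw [← Real.rpow_add hr]
    ring_nf
  rw [powBracket, this]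
  ring

lemma logBracket_eq_mul {τ r : ℝ} (hr : 0 < r) :
    logBracket N s τ r = r ^ τ * Real.log r * (r ^ (2 * s - N - 2 * τ) - 1) := by
  have : r ^ (2 * s - N - τ) = r ^ τ * r ^ (2 * s - N - 2 * τ) := by
    rw [← Real.rpow_add hr]
    ring_nf
  rw [logBracket, this]
  ring

lemma integrable_powBracket_div (hN : 2 ≤ N) (hs : 0 < s) (hs1 : s < 1) {τ : ℝ}
    (h1 : -(N : ℝ) < τ) (h2 : τ < 2 * s) :
    Integrable (fun z : EuclideanSpace ℝ (Fin N) =>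
      powBracket N s τ ‖z‖ / (1 + ‖z‖ ^ ((N : ℝ) + 2 * s))) := by
  have hN' : (2 : ℝ) ≤ N := by exact_mod_cast hN
  have i := fun (γ : ℝ) => integrable_norm_rpow_div (N := N) (s := s) (γ := γ) (by omega)
  refine ((((i 0 (by linarith) (by linarith)).add (i (2 * s - N) (by linarith) (by linarith))).sub
    (i τ h1 h2)).sub (i (2 * s - N - τ) (by linarith) (by linarith))).congr (.of_forall fun z => ?_)
  simp only [Pi.add_apply, Pi.sub_apply, Real.rpow_zero, powBracket]
  ring

lemma integrableOn_powBracket (hN : 2 ≤ N) (hs : 0 < s) (hs1 : s < 1) {τ : ℝ}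
    (h1 : -(N : ℝ) < τ) (h2 : τ < 2 * s) {e : EuclideanSpace ℝ (Fin N)} (he : ‖e‖ = 1) :
    IntegrableOn (fun w => powBracket N s τ ‖w‖ / ‖e - w‖ ^ ((N : ℝ) + 2 * s))
      {w | 1 < ‖w‖} := by
  obtain ⟨C, hC0, hC⟩ := exists_abs_rpow_sub_one_le τ
  obtain ⟨D, hD0, hD⟩ := exists_abs_rpow_sub_one_le (2 * s - N - τ)
  refine integrableOn_exterior_div (by omega) hs hs1 (integrable_powBracket_div hN hs hs1 h1 h2)
    (C := C * D) (fun r hr => ?_) he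
  rw [powBracket_eq_mul (by linarith [hr.1]), abs_mul, abs_sub_comm, abs_sub_comm 1]
  have : 0 ≤ r - 1 := sub_nonneg.2 hr.1
  calc |r ^ τ - 1| * |r ^ (2 * s - N - τ) - 1| ≤ (C * (r - 1)) * (D * (r - 1)) := by
        gcongr
        · exact hC r hr
        · exact hD r hr
    _ = C * D * (r - 1) ^ 2 := by ring

lemma abs_rpow_mul_log_le_of_mem_Icc {τ C : ℝ} (hC0 : 0 ≤ C)
    (hC : ∀ r ∈ Icc (1 : ℝ) 2, |r ^ τ - 1| ≤ C * (r - 1)) {r : ℝ} (hr : r ∈ Icc (1 : ℝ) 2) :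
    |r ^ τ * Real.log r| ≤ (C + 1) * (r - 1) := by
  have h0 : 0 < r := by linarith [hr.1]
  have h1 : 0 ≤ r - 1 := sub_nonneg.2 hr.1
  have h2 : r ^ τ ≤ C + 1 := by
    have h3 := (abs_le.1 (hC r hr)).2
    have h4 : C * (r - 1) ≤ C * 1 := by
      gcongr
      linarith [hr.2]
    linarith
  rw [abs_of_nonneg (mul_nonneg (by positivity) (Real.log_nonneg hr.1))]
  gcongr
  · exact Real.log_nonneg hr.1
  · exact Real.log_le_sub_one_of_pos h0

lemma integrableOn_logBracket (hN : 2 ≤ N) (hs : 0 < s) (hs1 : s < 1) {τ : ℝ}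
    (h1 : -(N : ℝ) < τ) (h2 : τ < 2 * s) {e : EuclideanSpace ℝ (Fin N)} (he : ‖e‖ = 1) :
    IntegrableOn (fun w => logBracket N s τ ‖w‖ / ‖e - w‖ ^ ((N : ℝ) + 2 * s))
      {w | 1 < ‖w‖} := by
  obtain ⟨C, hC0, hC⟩ := exists_abs_rpow_sub_one_le τ
  obtain ⟨D, hD0, hD⟩ := exists_abs_rpow_sub_one_le (2 * s - N - 2 * τ)
  have i := fun (γ : ℝ) => integrable_norm_rpow_mul_log_div (N := N) (s := s) (γ := γ) (by omega)
  have hint : Integrable (fun z : EuclideanSpace ℝ (Fin N) =>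
      logBracket N s τ ‖z‖ / (1 + ‖z‖ ^ ((N : ℝ) + 2 * s))) := by
    refine ((i (2 * s - N - τ) (by linarith) (by linarith)).sub (i τ h1 h2)).congr
      (.of_forall fun z => ?_)
    simp only [Pi.sub_apply, logBracket]
    ring
  refine integrableOn_exterior_div (by omega) hs hs1 hint (C := (C + 1) * D) (fun r hr => ?_) he
  have : 0 ≤ r - 1 := sub_nonneg.2 hr.1
  rw [logBracket_eq_mul (by linarith [hr.1]), abs_mul]
  calc |r ^ τ * Real.log r| * |r ^ (2 * s - N - 2 * τ) - 1|
      ≤ ((C + 1) * (r - 1)) * (D * (r - 1)) := by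
        gcongr
        · exact abs_rpow_mul_log_le_of_mem_Icc hC0 hC hr
        · exact hD r hr
    _ = (C + 1) * D * (r - 1) ^ 2 := by ring

lemma hasFracLaplacianAt_rpow_of_norm_eq_one (hN : 2 ≤ N) (hs : 0 < s) (hs1 : s < 1) {τ : ℝ}
    (h1 : -(N : ℝ) < τ) (h2 : τ < 2 * s) {e : EuclideanSpace ℝ (Fin N)} (he : ‖e‖ = 1) :
    HasFracLaplacianAt s (fun x => ‖x‖ ^ τ) e (symbol s e τ) := by
  have hi := integrable_norm_rpow_div (N := N) (s := s) (by omega) h1 h2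
  refine ⟨fun ε hε => integrableOn_sub_div (by omega) hs hi _ he hε, ?_⟩
  obtain ⟨C, hC0, hC⟩ := exists_abs_rpow_sub_one_le τ
  have := tendsto_setIntegral_compl_ball (f := fun r => r ^ τ) (G := powBracket N s τ)
    (by omega) hs hs1 hi (fun r hr => ?_) (C := C) (by simpa using hC) he
    (integrableOn_powBracket hN hs hs1 h1 h2 he)
  · simp only [he]
    exact this.const_mul _
  · have hr0 : 0 < r := by linarith
    rw [Real.one_rpow, Real.inv_rpow hr0.le, powBracket, Real.rpow_sub hr0 (2 * s - N)]
    field_simp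
    ring

lemma hasFracLaplacianAt_rpow_mul_log_of_norm_eq_one (hN : 2 ≤ N) (hs : 0 < s) (hs1 : s < 1)
    {τ : ℝ} (h1 : -(N : ℝ) < τ) (h2 : τ < 2 * s) {e : EuclideanSpace ℝ (Fin N)}
    (he : ‖e‖ = 1) :
    HasFracLaplacianAt s (fun x => ‖x‖ ^ τ * Real.log ‖x‖) e
      (normConst N s * extIntegral s e (logBracket N s τ)) := by
  have hi := integrable_norm_rpow_mul_log_div (N := N) (s := s) (by omega) h1 h2
  refine ⟨fun ε hε => integrableOn_sub_div (by omega) hs hi _ he hε, ?_⟩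
  obtain ⟨C, hC0, hC⟩ := exists_abs_rpow_sub_one_le τ
  have := tendsto_setIntegral_compl_ball (f := fun r => r ^ τ * Real.log r)
    (G := logBracket N s τ) (by omega) hs hs1 hi (fun r hr => ?_) (C := C + 1)
    (by simpa using fun r h1 h2 => abs_rpow_mul_log_le_of_mem_Icc hC0 hC ⟨h1, h2⟩) he
    (integrableOn_logBracket hN hs hs1 h1 h2 he)
  · simp only [he]
    exact this.const_mul _
  · have hr0 : 0 < r := by linarith
    rw [Real.log_one, Real.inv_rpow hr0.le, Real.log_inv, logBracket,
      Real.rpow_sub hr0 (2 * s - N)]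
    field_simp
    ring

/-- `(-Δ)^s |x|^τ = c(τ) |x|^(τ - 2s)` away from the origin. -/
theorem hasFracLaplacianAt_rpow (hN : 2 ≤ N) (hs : 0 < s) (hs1 : s < 1) {τ : ℝ}
    (h1 : -(N : ℝ) < τ) (h2 : τ < 2 * s) {e : EuclideanSpace ℝ (Fin N)} (he : ‖e‖ = 1)
    {x : EuclideanSpace ℝ (Fin N)} (hx : x ≠ 0) :
    HasFracLaplacianAt s (fun x => ‖x‖ ^ τ) x (‖x‖ ^ (τ - 2 * s) * symbol s e τ) := by
  obtain ⟨R, hR⟩ := exists_linearIsometryEquiv_apply_eq he hx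
  have hρ : 0 < ‖x‖ := norm_pos_iff.2 hx
  have h := hasFracLaplacianAt_rpow_of_norm_eq_one hN hs hs1 h1 h2 he
  have h' : HasFracLaplacianAt s (fun w => ‖‖x‖ • R w‖ ^ τ) e (‖x‖ ^ τ * symbol s e τ) := by
    convert h.linear_combination h (‖x‖ ^ τ) 0 using 1
    · funext w
      rw [norm_smul, norm_norm, R.norm_map, Real.mul_rpow hρ.le (norm_nonneg _)]
      ring
    · ring
  have := h'.of_comp_smul_isometry (u := fun x => ‖x‖ ^ τ) hρ R
  rw [hR, ← mul_assoc, ← Real.rpow_add hρ, neg_add_eq_sub] at this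
  exact this

/-- At the exponent `(2s - N)/2`, the centre of symmetry of `c`, differentiating
`(-Δ)^s |x|^τ = c(τ) |x|^(τ - 2s)` in `τ` produces no additional term. -/
theorem hasFracLaplacianAt_rpow_mul_log (hN : 2 ≤ N) (hs : 0 < s) (hs1 : s < 1) {τ : ℝ}
    (hτ : τ = (2 * s - N) / 2) {e : EuclideanSpace ℝ (Fin N)} (he : ‖e‖ = 1)
    {x : EuclideanSpace ℝ (Fin N)} (hx : x ≠ 0) :
    HasFracLaplacianAt s (fun x => -(‖x‖ ^ τ * Real.log ‖x‖)) x
      (-(‖x‖ ^ (τ - 2 * s) * Real.log ‖x‖ * symbol s e τ)) := by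
  have hN' : (2 : ℝ) ≤ N := by exact_mod_cast hN
  obtain ⟨R, hR⟩ := exists_linearIsometryEquiv_apply_eq he hx
  have hρ : 0 < ‖x‖ := norm_pos_iff.2 hx
  have h1 : -(N : ℝ) < τ := by rw [hτ]; linarith
  have h2 : τ < 2 * s := by rw [hτ]; linarith
  have h := hasFracLaplacianAt_rpow_of_norm_eq_one hN hs hs1 h1 h2 he
  have hlog := hasFracLaplacianAt_rpow_mul_log_of_norm_eq_one hN hs hs1 h1 h2 he
  have h0 : extIntegral s e (logBracket N s τ) = 0 := by
    have : 2 * s - N - τ = τ := by rw [hτ]; ring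
    simp [extIntegral, logBracket, this]
  have h' : HasFracLaplacianAt s (fun w => -(‖‖x‖ • R w‖ ^ τ * Real.log ‖‖x‖ • R w‖)) e
      (-(‖x‖ ^ τ * Real.log ‖x‖ * symbol s e τ)) := by
    convert h.linear_combination hlog (-(‖x‖ ^ τ * Real.log ‖x‖)) (-‖x‖ ^ τ) using 1
    · funext w
      rw [norm_smul, norm_norm, R.norm_map, Real.mul_rpow hρ.le (norm_nonneg _)]
      rcases eq_or_ne w 0 with rfl | hw
      -- at the origin the logarithm of the product need not split, but `0 ^ τ = 0` kills both sides
      · have : τ ≠ 0 := by rw [hτ]; linarith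
        simp [Real.zero_rpow this]
      · rw [Real.log_mul hρ.ne' (norm_ne_zero_iff.2 hw)]
        ring
    · rw [h0]
      ring
  have := h'.of_comp_smul_isometry (u := fun x => -(‖x‖ ^ τ * Real.log ‖x‖)) hρ R
  rw [hR] at this
  convert this using 1
  rw [Real.rpow_sub hρ, Real.rpow_neg hρ.le]
  ring

/-! ### Symmetry, monotonicity and continuity of the symbol -/

lemma measurableSet_exterior (c : ℝ) :
    MeasurableSet {w : EuclideanSpace ℝ (Fin N) | c < ‖w‖} :=
  measurableSet_lt measurable_const measurable_norm

lemma normConst_pos (hs : 0 < s) (hs1 : s < 1) : 0 < normConst N s := by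
  have h1 : 0 < Real.Gamma (((N : ℝ) + 2 * s) / 2) := Real.Gamma_pos_of_pos (by positivity)
  have h2 : 0 < Real.Gamma (1 - s) := Real.Gamma_pos_of_pos (by linarith)
  have := Real.pi_pos
  unfold normConst
  positivity

lemma symbol_symm (s : ℝ) (e : EuclideanSpace ℝ (Fin N)) (τ : ℝ) :
    symbol s e (2 * s - N - τ) = symbol s e τ := by
  have : powBracket N s (2 * s - N - τ) = powBracket N s τ := by
    funext r
    rw [powBracket, powBracket, sub_sub_cancel]
    ring
  rw [symbol, this, symbol]

lemma symbol_zero (s : ℝ) (e : EuclideanSpace ℝ (Fin N)) : symbol s e 0 = 0 := by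
  simp [symbol, extIntegral, powBracket]

lemma powBracket_lt {τ τ' r : ℝ} (hτ : (2 * s - N) / 2 ≤ τ) (h : τ < τ') (hr : 1 < r) :
    powBracket N s τ' r < powBracket N s τ r := by
  have hr0 : 0 < r := by linarith
  have h1 : r ^ (2 * s - N - τ) = r ^ τ' * r ^ (2 * s - N - τ - τ') := by
    rw [← Real.rpow_add hr0]
    ring_nf
  have h2 : r ^ (2 * s - N - τ') = r ^ τ * r ^ (2 * s - N - τ - τ') := by
    rw [← Real.rpow_add hr0]
    ring_nf
  have h3 : r ^ τ < r ^ τ' := Real.rpow_lt_rpow_of_exponent_lt hr h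
  have h4 : r ^ (2 * s - N - τ - τ') < 1 :=
    Real.rpow_lt_one_of_one_lt_of_neg hr (by linarith)
  have h5 := mul_pos (sub_pos.2 h3) (sub_pos.2 h4)
  rw [powBracket, powBracket, h1, h2]
  linarith

lemma extIntegral_pos {G : ℝ → ℝ} (hG : ∀ r, 1 < r → 0 < G r)
    {e : EuclideanSpace ℝ (Fin N)} (he : ‖e‖ = 1)
    (hi : IntegrableOn (fun w => G ‖w‖ / ‖e - w‖ ^ ((N : ℝ) + 2 * s)) {w | 1 < ‖w‖}) :
    0 < extIntegral s e G := by
  have hpos : ∀ w : EuclideanSpace ℝ (Fin N), 1 < ‖w‖ →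
      0 < G ‖w‖ / ‖e - w‖ ^ ((N : ℝ) + 2 * s) := fun w hw => by
    have hd : 0 < ‖e - w‖ := by
      rw [norm_pos_iff, sub_ne_zero]
      rintro rfl
      linarith
    exact div_pos (hG _ hw) (by positivity)
  rw [extIntegral, setIntegral_pos_iff_support_of_nonneg_ae
    ((ae_restrict_mem (measurableSet_exterior 1)).mono fun w hw => (hpos w hw).le) hi]
  have hsub : {w : EuclideanSpace ℝ (Fin N) | 1 < ‖w‖} ⊆
      (Function.support fun w => G ‖w‖ / ‖e - w‖ ^ ((N : ℝ) + 2 * s)) ∩ {w | 1 < ‖w‖} :=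
    fun w hw => ⟨(hpos w hw).ne', hw⟩
  refine lt_of_lt_of_le ?_ (measure_mono hsub)
  refine IsOpen.measure_pos volume (isOpen_lt continuous_const continuous_norm) ⟨(2 : ℝ) • e, ?_⟩
  simp [norm_smul, he]

lemma symbol_lt (hN : 2 ≤ N) (hs : 0 < s) (hs1 : s < 1) {e : EuclideanSpace ℝ (Fin N)}
    (he : ‖e‖ = 1) {τ τ' : ℝ} (hτ : (2 * s - N) / 2 ≤ τ) (h : τ < τ') (h' : τ' < 2 * s) :
    symbol s e τ' < symbol s e τ := by
  have hN' : (2 : ℝ) ≤ N := by exact_mod_cast hN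
  have i1 := integrableOn_powBracket hN hs hs1 (τ := τ) (by linarith) (by linarith) he
  have i2 := integrableOn_powBracket hN hs hs1 (τ := τ') (by linarith) h' he
  refine mul_lt_mul_of_pos_left ?_ (normConst_pos hs hs1)
  have hsub := i1.sub i2
  simp only [Pi.sub_def, ← sub_div] at hsub
  have := extIntegral_pos (G := fun r => powBracket N s τ r - powBracket N s τ' r)
    (fun r hr => sub_pos.2 (powBracket_lt hτ h hr)) he hsub
  simp only [extIntegral, sub_div] at this ⊢
  rwa [integral_sub i1 i2, sub_pos] at this

lemma extIntegral_logBracket_pos (hN : 2 ≤ N) (hs : 0 < s) (hs1 : s < 1)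
    {e : EuclideanSpace ℝ (Fin N)} (he : ‖e‖ = 1) {τ : ℝ} (h1 : -(N : ℝ) < τ)
    (h2 : τ < (2 * s - N) / 2) : 0 < extIntegral s e (logBracket N s τ) := by
  have hN' : (2 : ℝ) ≤ N := by exact_mod_cast hN
  refine extIntegral_pos (fun r hr => ?_) he
    (integrableOn_logBracket hN hs hs1 h1 (by linarith) he)
  have hr0 : 0 < r := by linarith
  rw [logBracket_eq_mul hr0]
  exact mul_pos (mul_pos (by positivity) (Real.log_pos hr))
    (sub_pos.2 (Real.one_lt_rpow hr (by linarith)))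

lemma concaveOn_powBracket {r : ℝ} (hr : 0 < r) :
    ConcaveOn ℝ univ fun τ => powBracket N s τ r := by
  refine ⟨convex_univ, fun x _ y _ a b ha hb hab => ?_⟩
  have h := convexOn_rpow_left hr
  have h1 := h.2 (mem_univ x) (mem_univ y) ha hb hab
  have h2 := h.2 (mem_univ (2 * s - N - x)) (mem_univ (2 * s - N - y)) ha hb hab
  have h3 : 2 * s - N - (a * x + b * y) = a * (2 * s - N - x) + b * (2 * s - N - y) := by
    linear_combination (-(2 * s - N)) * hab
  simp only [smul_eq_mul] at h1 h2 ⊢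
  simp only [powBracket, h3]
  linear_combination h1 + h2 + (1 + r ^ (2 * s - N)) * hab

/-- `c` is concave on its domain of definition, since `τ ↦ r ^ τ` is convex; a concave function on
an open interval is continuous. -/
lemma continuousOn_symbol (hN : 2 ≤ N) (hs : 0 < s) (hs1 : s < 1)
    {e : EuclideanSpace ℝ (Fin N)} (he : ‖e‖ = 1) :
    ContinuousOn (symbol s e) (Ioo (-(N : ℝ)) (2 * s)) := by
  have i := fun (τ : ℝ) (h : τ ∈ Ioo (-(N : ℝ)) (2 * s)) =>
    integrableOn_powBracket hN hs hs1 h.1 h.2 he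
  have hc : ConcaveOn ℝ (Ioo (-(N : ℝ)) (2 * s)) fun τ => extIntegral s e (powBracket N s τ) := by
    refine ⟨convex_Ioo _ _, fun x hx y hy a b ha hb hab => ?_⟩
    have hz : a • x + b • y ∈ Ioo (-(N : ℝ)) (2 * s) := convex_Ioo _ _ hx hy ha hb hab
    simp only [extIntegral, smul_eq_mul] at hz ⊢
    rw [← integral_const_mul, ← integral_const_mul,
      ← integral_add ((i x hx).const_mul a) ((i y hy).const_mul b)]
    refine setIntegral_mono_on (((i x hx).const_mul a).add ((i y hy).const_mul b)) (i _ hz)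
      (measurableSet_exterior 1) fun w hw => ?_
    have hw1 : 1 < ‖w‖ := hw
    have := (concaveOn_powBracket (N := N) (s := s) (r := ‖w‖) (by linarith)).2 (mem_univ x)
      (mem_univ y) ha hb hab
    simp only [smul_eq_mul] at this
    rw [← mul_div_assoc, ← mul_div_assoc, ← add_div]
    gcongr
  exact (hc.continuousOn isOpen_Ioo).const_mul _

lemma integrableOn_exterior_rpow (hN : 1 ≤ N) {q : ℝ} (hq : q < -(N : ℝ)) :
    IntegrableOn (fun w : EuclideanSpace ℝ (Fin N) => ‖w‖ ^ q) {w | 2 < ‖w‖} ∧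
    ∫ w in {w : EuclideanSpace ℝ (Fin N) | 2 < ‖w‖}, ‖w‖ ^ q =
      N * volume.real (ball (0 : EuclideanSpace ℝ (Fin N)) 1) * (2 ^ (q + N) / (-(q + N))) := by
  have : Nonempty (Fin N) := ⟨⟨0, hN⟩⟩
  have hind : ∀ w : EuclideanSpace ℝ (Fin N), {w | 2 < ‖w‖}.indicator (fun w => ‖w‖ ^ q) w =
      (Ioi (2 : ℝ)).indicator (fun r => r ^ q) ‖w‖ := fun w => by
    by_cases h : 2 < ‖w‖ <;> simp [h]
  have hfun : EqOn (fun y : ℝ => y ^ (N - 1) • (Ioi (2 : ℝ)).indicator (fun r => r ^ q) y)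
      ((Ioi (2 : ℝ)).indicator fun y => y ^ (q + N - 1)) (Ioi 0) := fun y hy => by
    by_cases h : 2 < y
    · have hy0 : (0 : ℝ) < y := hy
      simp only [indicator_of_mem (mem_Ioi.2 h), smul_eq_mul]
      rw [← Real.rpow_natCast, ← Real.rpow_add hy0, Nat.cast_sub hN, Nat.cast_one]
      ring_nf
    · have : y ∉ Ioi (2 : ℝ) := h
      simp [indicator_of_notMem this]
  have hsub : Ioi (2 : ℝ) ⊆ Ioi 0 := Ioi_subset_Ioi (by norm_num)
  constructor
  · rw [← integrable_indicator_iff (measurableSet_exterior 2)]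
    rw [integrable_congr (.of_forall hind)]
    rw [integrable_fun_norm_addHaar volume (f := (Ioi (2 : ℝ)).indicator fun r => r ^ q)]
    simp only [finrank_euclideanSpace, Fintype.card_fin]
    rw [integrableOn_congr_fun hfun measurableSet_Ioi]
    exact (IntegrableOn.integrable_indicator
      (integrableOn_Ioi_rpow_of_lt (by linarith) (by norm_num)) measurableSet_Ioi).integrableOn
  · rw [← integral_indicator (measurableSet_exterior 2)]
    simp only [hind]
    rw [integral_fun_norm_addHaar volume ((Ioi (2 : ℝ)).indicator fun r => r ^ q)]
    simp only [finrank_euclideanSpace, Fintype.card_fin]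
    rw [setIntegral_congr_fun measurableSet_Ioi hfun, setIntegral_indicator measurableSet_Ioi,
      inter_eq_right.2 hsub, integral_Ioi_rpow_of_lt (by linarith) (by norm_num)]
    simp only [nsmul_eq_mul, smul_eq_mul, sub_add_cancel]
    rw [div_neg, neg_div]
    ring

/-- An upper bound of order `-1 / (2s - τ)`: on `‖w‖ > 2` the integrand is comparable to
`-‖w‖ ^ (τ - (N + 2s))`, and on the rest of the exterior it is nonpositive. -/
lemma extIntegral_powBracket_le (hN : 2 ≤ N) (hs : 0 < s) (hs1 : s < 1)
    {e : EuclideanSpace ℝ (Fin N)} (he : ‖e‖ = 1) {τ : ℝ} (hτ0 : 0 ≤ τ) (hτ : τ < 2 * s) :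
    extIntegral s e (powBracket N s τ) ≤
      -((1 - 2 ^ (2 * s - N)) * (2 ^ ((N : ℝ) + 2 * s))⁻¹ *
        (N * volume.real (ball (0 : EuclideanSpace ℝ (Fin N)) 1) *
          (2 ^ (τ - 2 * s) / (2 * s - τ) - 2 ^ (-(2 * s)) / (2 * s)))) := by
  have hN' : (2 : ℝ) ≤ N := by exact_mod_cast hN
  set p : ℝ := (N : ℝ) + 2 * s with hp
  set κ : ℝ := 1 - 2 ^ (2 * s - N) with hκ
  have hi := integrableOn_powBracket hN hs hs1 (τ := τ) (by linarith) hτ he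
  have hsub : {w : EuclideanSpace ℝ (Fin N) | 2 < ‖w‖} ⊆ {w | 1 < ‖w‖} := fun w hw => by
    have hw2 : 2 < ‖w‖ := hw
    exact lt_trans one_lt_two hw2
  obtain ⟨j1, e1⟩ := integrableOn_exterior_rpow (N := N) (by omega) (q := τ - p) (by linarith)
  obtain ⟨j2, e2⟩ := integrableOn_exterior_rpow (N := N) (by omega) (q := -p) (by linarith)
  have hfac : ∀ r : ℝ, 1 < r → powBracket N s τ r = -((r ^ τ - 1) * (1 - r ^ (2 * s - N - τ))) :=
    fun r hr => by
      rw [powBracket_eq_mul (by linarith)]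
      ring
  have hnonpos : ∀ r : ℝ, 1 < r → powBracket N s τ r ≤ 0 := fun r hr => by
    rw [hfac r hr, neg_nonpos]
    exact mul_nonneg (sub_nonneg.2 (Real.one_le_rpow hr.le hτ0))
      (sub_nonneg.2 (Real.rpow_le_one_of_one_le_of_nonpos hr.le (by linarith)))
  have h1 : extIntegral s e (powBracket N s τ) ≤
      ∫ w in {w : EuclideanSpace ℝ (Fin N) | 2 < ‖w‖}, powBracket N s τ ‖w‖ / ‖e - w‖ ^ p := by
    have := setIntegral_mono_set (f := fun w : EuclideanSpace ℝ (Fin N) =>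
      -(powBracket N s τ ‖w‖ / ‖e - w‖ ^ p)) hi.neg
      ((ae_restrict_mem (measurableSet_exterior 1)).mono fun w hw => by
        have := div_nonpos_of_nonpos_of_nonneg (hnonpos _ hw)
          (by positivity : 0 ≤ ‖e - w‖ ^ p)
        simpa using this) (LE.le.eventuallyLE hsub)
    rw [integral_neg, integral_neg] at this
    exact neg_le_neg_iff.1 this
  have h2 : ∫ w in {w : EuclideanSpace ℝ (Fin N) | 2 < ‖w‖}, powBracket N s τ ‖w‖ / ‖e - w‖ ^ p ≤
      ∫ w in {w : EuclideanSpace ℝ (Fin N) | 2 < ‖w‖},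
        -(κ * (2 ^ p)⁻¹ * (‖w‖ ^ (τ - p) - ‖w‖ ^ (-p))) := by
    refine setIntegral_mono_on (hi.mono_set hsub) ((j1.sub j2).const_mul _).neg
      (measurableSet_exterior 2) fun w hw => ?_
    have hw2 : 2 < ‖w‖ := hw
    have hw0 : 0 < ‖w‖ := by linarith
    have hd : 0 < ‖e - w‖ := by
      rw [norm_pos_iff, sub_ne_zero]
      rintro rfl
      linarith
    have hd2 : ‖e - w‖ ≤ 2 * ‖w‖ := by
      have := norm_sub_le e w
      linarith
    rw [hfac _ (by linarith), neg_div, neg_le_neg_iff, Real.rpow_sub hw0, Real.rpow_neg hw0.le]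
    have hk : κ ≤ 1 - ‖w‖ ^ (2 * s - N - τ) := by
      have h3 : ‖w‖ ^ (2 * s - N - τ) ≤ ‖w‖ ^ (2 * s - N) :=
        Real.rpow_le_rpow_of_exponent_le (by linarith) (by linarith)
      have h4 : ‖w‖ ^ (2 * s - N) ≤ 2 ^ (2 * s - N) :=
        Real.rpow_le_rpow_of_nonpos (by norm_num) hw2.le (by linarith)
      rw [hκ]
      linarith
    have h5 : 0 ≤ ‖w‖ ^ τ - 1 := sub_nonneg.2 (Real.one_le_rpow (by linarith) hτ0)
    have hκ0 : 0 ≤ κ := by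
      rw [hκ, sub_nonneg]
      exact Real.rpow_le_one_of_one_le_of_nonpos (by norm_num) (by linarith)
    calc κ * (2 ^ p)⁻¹ * (‖w‖ ^ τ / ‖w‖ ^ p - (‖w‖ ^ p)⁻¹) =
          (‖w‖ ^ τ - 1) * κ / (2 * ‖w‖) ^ p := by
            rw [Real.mul_rpow (by norm_num) hw0.le]
            field_simp
      _ ≤ (‖w‖ ^ τ - 1) * (1 - ‖w‖ ^ (2 * s - N - τ)) / ‖e - w‖ ^ p := by
          gcongr
          exact mul_nonneg h5 (hκ0.trans hk)
  refine (h1.trans h2).trans_eq ?_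
  rw [integral_neg, integral_const_mul, integral_sub j1 j2, e1, e2]
  have q1 : τ - p + N = τ - 2 * s := by rw [hp]; ring
  have q2 : -p + N = -(2 * s) := by rw [hp]; ring
  rw [q1, q2, neg_sub, neg_neg]
  ring

lemma tendsto_symbol_atBot (hN : 2 ≤ N) (hs : 0 < s) (hs1 : s < 1)
    {e : EuclideanSpace ℝ (Fin N)} (he : ‖e‖ = 1) :
    Tendsto (symbol s e) (𝓝[<] (2 * s)) atBot := by
  have hN' : (2 : ℝ) ≤ N := by exact_mod_cast hN
  set A : ℝ := (1 - 2 ^ (2 * s - N)) * (2 ^ ((N : ℝ) + 2 * s))⁻¹ with hA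
  have hA0 : 0 < A := by
    have : (2 : ℝ) ^ (2 * s - N) < 1 :=
      Real.rpow_lt_one_of_one_lt_of_neg (by norm_num) (by linarith)
    have := sub_pos.2 this
    positivity
  set B : ℝ := N * volume.real (ball (0 : EuclideanSpace ℝ (Fin N)) 1) with hB
  have hB0 : 0 < B := by
    have : 0 < volume.real (ball (0 : EuclideanSpace ℝ (Fin N)) 1) :=
      ENNReal.toReal_pos (measure_ball_pos _ _ one_pos).ne' measure_ball_lt_top.ne
    positivity
  have hlim : Tendsto (fun τ : ℝ => 2 ^ (τ - 2 * s) / (2 * s - τ) - 2 ^ (-(2 * s)) / (2 * s))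
      (𝓝[<] (2 * s)) atTop := by
    have h1 : Tendsto (fun τ : ℝ => (2 : ℝ) ^ (τ - 2 * s)) (𝓝[<] (2 * s)) (𝓝 1) := by
      have : Continuous fun τ : ℝ => (2 : ℝ) ^ (τ - 2 * s) :=
        Continuous.rpow continuous_const (by fun_prop) fun _ => Or.inl (by norm_num)
      have h := this.tendsto (2 * s)
      rw [sub_self, Real.rpow_zero] at h
      exact h.mono_left nhdsWithin_le_nhds
    have h2 : Tendsto (fun τ : ℝ => (2 * s - τ)⁻¹) (𝓝[<] (2 * s)) atTop := by
      refine tendsto_inv_nhdsGT_zero.comp (tendsto_nhdsWithin_iff.2 ⟨?_, ?_⟩)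
      · have : Continuous fun τ : ℝ => 2 * s - τ := by fun_prop
        have h := this.tendsto (2 * s)
        rw [sub_self] at h
        exact h.mono_left nhdsWithin_le_nhds
      · filter_upwards [self_mem_nhdsWithin] with τ hτ
        have hτ' : τ < 2 * s := hτ
        exact sub_pos.2 hτ'
    exact tendsto_atTop_add_const_right _ _ (h1.pos_mul_atTop one_pos h2)
  have hlim2 := ((hlim.const_mul_atTop hB0).const_mul_atTop hA0).const_mul_atTop
    (normConst_pos (N := N) hs hs1)
  refine tendsto_atBot_mono' _ ?_ (tendsto_neg_atTop_atBot.comp hlim2)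
  filter_upwards [Ioo_mem_nhdsLT (show (0 : ℝ) < 2 * s by linarith)] with τ hτ
  simp only [Function.comp]
  rw [← mul_neg]
  exact mul_le_mul_of_nonneg_left (extIntegral_powBracket_le hN hs hs1 he hτ.1.le hτ.2)
    (normConst_pos hs hs1).le

/-! ### Gamma, beta and Gaussian integrals -/

/-- Tonelli's theorem for real-valued functions: an integrable iterated integral in one order gives
the other order. -/
lemma integral_swap_of_nonneg {α β : Type*} [MeasurableSpace α] [MeasurableSpace β]
    {μ : Measure α} {ν : Measure β} [SFinite μ] [SFinite ν] {f : α → β → ℝ}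
    (hm : AEStronglyMeasurable (Function.uncurry f) (μ.prod ν))
    (h0 : ∀ᵐ a ∂μ, ∀ᵐ b ∂ν, 0 ≤ f a b) (h1 : ∀ᵐ a ∂μ, Integrable (f a) ν)
    (h2 : Integrable (fun a => ∫ b, f a b ∂ν) μ) :
    Integrable (fun b => ∫ a, f a b ∂μ) ν ∧
      ∫ b, ∫ a, f a b ∂μ ∂ν = ∫ a, ∫ b, f a b ∂ν ∂μ := by
  have hf : Integrable (Function.uncurry f) (μ.prod ν) := by
    refine (integrable_prod_iff hm).2 ⟨h1, h2.congr ?_⟩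
    filter_upwards [h0] with a ha
    exact integral_congr_ae (ha.mono fun b hb => (Real.norm_of_nonneg hb).symm)
  exact ⟨hf.integral_prod_right, (integral_integral_swap hf).symm⟩

lemma integrableOn_rpow_mul_exp_neg_mul_Ioi {a r : ℝ} (ha : 0 < a) (hr : 0 < r) :
    IntegrableOn (fun t : ℝ => t ^ (a - 1) * Real.exp (-(r * t))) (Ioi 0) := by
  have := integrableOn_rpow_mul_exp_neg_mul_rpow (p := 1) (s := a - 1) (b := r) (by linarith)
    one_pos hr
  simpa only [Real.rpow_one, neg_mul] using this

/-- Euler's second integral for the beta function. -/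
lemma integral_rpow_mul_one_add_rpow {p q : ℝ} (hp : 0 < p) (hq : 0 < q) :
    IntegrableOn (fun t : ℝ => t ^ (p - 1) * (1 + t) ^ (-(p + q))) (Ioi 0) ∧
    ∫ t in Ioi (0 : ℝ), t ^ (p - 1) * (1 + t) ^ (-(p + q)) =
      Real.Gamma p * Real.Gamma q / Real.Gamma (p + q) := by
  have hpq : 0 < p + q := by linarith
  set f : ℝ → ℝ → ℝ := fun t l =>
    l ^ (p - 1) * (t ^ (p + q - 1) * Real.exp (-((1 + l) * t))) with hf
  have hm : Measurable (Function.uncurry f) := by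
    unfold f Function.uncurry
    fun_prop
  have hsplit : ∀ t l, f t l = (t ^ (p + q - 1) * Real.exp (-t)) *
      (l ^ (p - 1) * Real.exp (-(t * l))) := fun t l => by
    have : Real.exp (-((1 + l) * t)) = Real.exp (-t) * Real.exp (-(t * l)) := by
      rw [← Real.exp_add]
      ring_nf
    simp only [hf, this]
    ring
  have hin : ∀ t ∈ Ioi (0 : ℝ), ∫ l in Ioi (0 : ℝ), f t l =
      Real.Gamma p * (Real.exp (-t) * t ^ (q - 1)) := fun t ht => by
    have ht0 : 0 < t := ht
    simp only [hsplit]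
    rw [integral_const_mul, Real.integral_rpow_mul_exp_neg_mul_Ioi hp ht0, one_div,
      Real.inv_rpow ht0.le, ← Real.rpow_neg ht0.le]
    have : t ^ (q - 1) = t ^ (p + q - 1) * t ^ (-p) := by
      rw [← Real.rpow_add ht0]
      ring_nf
    rw [this]
    ring
  have hout : ∀ l ∈ Ioi (0 : ℝ), ∫ t in Ioi (0 : ℝ), f t l =
      Real.Gamma (p + q) * (l ^ (p - 1) * (1 + l) ^ (-(p + q))) := fun l hl => by
    have hl0 : 0 < 1 + l := by
      have : 0 < l := hl
      linarith
    simp only [hf]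
    rw [integral_const_mul, Real.integral_rpow_mul_exp_neg_mul_Ioi hpq hl0, one_div,
      Real.inv_rpow hl0.le, ← Real.rpow_neg hl0.le]
    ring
  obtain ⟨h1, h2⟩ := integral_swap_of_nonneg (μ := volume.restrict (Ioi 0))
    (ν := volume.restrict (Ioi 0)) hm.aestronglyMeasurable
    ((ae_restrict_mem measurableSet_Ioi).mono fun t ht =>
      (ae_restrict_mem measurableSet_Ioi).mono fun l hl => by
        have ht0 : 0 < t := ht
        have hl0 : 0 < l := hl
        simp only [hf]
        positivity)
    ((ae_restrict_mem measurableSet_Ioi).mono fun t ht => by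
      rw [show f t = _ from funext (hsplit t)]
      exact (integrableOn_rpow_mul_exp_neg_mul_Ioi hp ht).const_mul _)
    (((Real.GammaIntegral_convergent hq).const_mul (Real.Gamma p)).congr
      ((ae_restrict_mem measurableSet_Ioi).mono fun t ht => (hin t ht).symm))
  have hG : Real.Gamma (p + q) ≠ 0 := (Real.Gamma_pos_of_pos hpq).ne'
  constructor
  · have h3 := (integrableOn_congr_fun hout measurableSet_Ioi).1 h1
    refine (h3.const_mul (Real.Gamma (p + q))⁻¹).congr (.of_forall fun l => ?_)
    simp only
    rw [inv_mul_cancel_left₀ hG]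
  · rw [setIntegral_congr_fun measurableSet_Ioi hout,
      setIntegral_congr_fun measurableSet_Ioi hin, integral_const_mul, integral_const_mul,
      ← Real.Gamma_eq_integral hq] at h2
    rw [eq_div_iff hG, mul_comm, h2]

/-- The surface measure of the sphere appears as `N` times the volume of the unit ball. -/
lemma integral_norm_rpow_mul_exp (hN : 1 ≤ N) {q κ : ℝ} (hq : -(N : ℝ) < q) (hκ : 0 < κ) :
    Integrable (fun x : EuclideanSpace ℝ (Fin N) => ‖x‖ ^ q * Real.exp (-(κ * ‖x‖ ^ 2))) ∧
    ∫ x : EuclideanSpace ℝ (Fin N), ‖x‖ ^ q * Real.exp (-(κ * ‖x‖ ^ 2)) =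
      N * volume.real (ball (0 : EuclideanSpace ℝ (Fin N)) 1) *
        (κ ^ (-((N + q) / 2)) * (1 / 2) * Real.Gamma ((N + q) / 2)) := by
  have : Nonempty (Fin N) := ⟨⟨0, hN⟩⟩
  have hfun : EqOn (fun y : ℝ => y ^ (N - 1) • (y ^ q * Real.exp (-(κ * y ^ 2))))
      (fun y => y ^ (N - 1 + q) * Real.exp (-κ * y ^ (2 : ℝ))) (Ioi 0) := fun y hy => by
    have hy0 : (0 : ℝ) < y := hy
    simp only [smul_eq_mul]
    rw [← mul_assoc, ← Real.rpow_natCast y (N - 1), ← Real.rpow_add hy0, Nat.cast_sub hN,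
      Nat.cast_one, Real.rpow_two, neg_mul]
  constructor
  · rw [integrable_fun_norm_addHaar volume (f := fun r => r ^ q * Real.exp (-(κ * r ^ 2)))]
    simp only [finrank_euclideanSpace, Fintype.card_fin]
    rw [integrableOn_congr_fun hfun measurableSet_Ioi]
    exact integrableOn_rpow_mul_exp_neg_mul_rpow (by linarith) (by norm_num) hκ
  · rw [integral_fun_norm_addHaar volume (fun r => r ^ q * Real.exp (-(κ * r ^ 2)))]
    simp only [finrank_euclideanSpace, Fintype.card_fin]
    rw [setIntegral_congr_fun measurableSet_Ioi hfun,
      integral_rpow_mul_exp_neg_mul_rpow (by norm_num) (by linarith) hκ]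
    have : (N : ℝ) - 1 + q + 1 = N + q := by ring
    rw [this, nsmul_eq_mul, smul_eq_mul, neg_div]
    ring

lemma integral_Ioc_exp_neg_mul {κ c : ℝ} (hκ : 0 ≤ κ) (hc : c ≠ 0) :
    ∫ t in Ioc 0 κ, Real.exp (-(t * c)) = (1 - Real.exp (-(κ * c))) / c := by
  rw [← intervalIntegral.integral_of_le hκ]
  have hd : ∀ t ∈ uIcc 0 κ, HasDerivAt (fun t => -Real.exp (-(t * c)) / c)
      (Real.exp (-(t * c))) t := fun t _ => by
    have h1 : HasDerivAt (fun t : ℝ => -(t * c)) (-(1 * c)) t :=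
      ((hasDerivAt_id t).mul_const c).neg
    have h2 : HasDerivAt (fun t => -Real.exp (-(t * c)) / c)
        (-(Real.exp (-(t * c)) * -(1 * c)) / c) t := h1.exp.neg.div_const c
    refine h2.congr_deriv ?_
    field_simp
  rw [intervalIntegral.integral_eq_sub_of_hasDerivAt hd (Continuous.intervalIntegrable
    (by fun_prop) _ _)]
  simp
  ring

/-- The value of `∫ (1 - e^{-κ|y|²}) |y|^{-(N+2s)} dy`, obtained from
`1 - e^{-κ r²} = ∫₀^κ r² e^{-t r²} dt`. -/
lemma integral_one_sub_exp_div (hN : 1 ≤ N) (hs : 0 < s) (hs1 : s < 1) {κ : ℝ} (hκ : 0 ≤ κ) :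
    Integrable (fun y : EuclideanSpace ℝ (Fin N) =>
      (1 - Real.exp (-(κ * ‖y‖ ^ 2))) / ‖y‖ ^ ((N : ℝ) + 2 * s)) ∧
    ∫ y : EuclideanSpace ℝ (Fin N),
      (1 - Real.exp (-(κ * ‖y‖ ^ 2))) / ‖y‖ ^ ((N : ℝ) + 2 * s) =
      N * volume.real (ball (0 : EuclideanSpace ℝ (Fin N)) 1) *
        (Real.Gamma (1 - s) / (2 * s)) * κ ^ s := by
  have : Nonempty (Fin N) := ⟨⟨0, hN⟩⟩
  set A : ℝ := N * volume.real (ball (0 : EuclideanSpace ℝ (Fin N)) 1) with hA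
  set f : ℝ → EuclideanSpace ℝ (Fin N) → ℝ := fun t y =>
    ‖y‖ ^ (2 - ((N : ℝ) + 2 * s)) * Real.exp (-(t * ‖y‖ ^ 2)) with hf
  have hm : Measurable (Function.uncurry f) := by
    unfold f Function.uncurry
    fun_prop
  have hin : ∀ t ∈ Ioc 0 κ, Integrable (f t) ∧
      ∫ y, f t y = A * ((1 / 2) * Real.Gamma (1 - s)) * t ^ (s - 1) := fun t ht => by
    obtain ⟨h1, h2⟩ := integral_norm_rpow_mul_exp hN (q := 2 - ((N : ℝ) + 2 * s)) (κ := t)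
      (by linarith) ht.1
    refine ⟨h1, h2.trans ?_⟩
    have e1 : ((N : ℝ) + (2 - (N + 2 * s))) / 2 = 1 - s := by ring
    rw [e1, neg_sub]
    ring
  have hint : IntegrableOn (fun t : ℝ => t ^ (s - 1)) (Ioc 0 κ) :=
    (intervalIntegrable_iff_integrableOn_Ioc_of_le hκ).1
      (intervalIntegral.intervalIntegrable_rpow' (by linarith))
  obtain ⟨h1, h2⟩ := integral_swap_of_nonneg (μ := volume.restrict (Ioc 0 κ)) (ν := volume)
    hm.aestronglyMeasurable (.of_forall fun t => .of_forall fun y => by simp only [hf]; positivity)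
    ((ae_restrict_mem measurableSet_Ioc).mono fun t ht => (hin t ht).1)
    ((hint.const_mul (A * ((1 / 2) * Real.Gamma (1 - s)))).congr
      ((ae_restrict_mem measurableSet_Ioc).mono fun t ht => (hin t ht).2.symm))
  have hae : (fun y : EuclideanSpace ℝ (Fin N) => ∫ t in Ioc 0 κ, f t y) =ᵐ[volume] fun y =>
      (1 - Real.exp (-(κ * ‖y‖ ^ 2))) / ‖y‖ ^ ((N : ℝ) + 2 * s) := by
    filter_upwards [Measure.ae_ne volume (0 : EuclideanSpace ℝ (Fin N))] with y hy
    have hy0 : 0 < ‖y‖ := norm_pos_iff.2 hy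
    simp only [hf]
    rw [integral_const_mul, integral_Ioc_exp_neg_mul hκ (by positivity), Real.rpow_sub hy0,
      Real.rpow_two]
    field_simp
  refine ⟨h1.congr hae, ?_⟩
  rw [← integral_congr_ae hae, h2, setIntegral_congr_fun measurableSet_Ioc
    (fun t ht => (hin t ht).2), integral_const_mul, ← intervalIntegral.integral_of_le hκ,
    integral_rpow (Or.inl (by linarith)), sub_add_cancel, Real.zero_rpow hs.ne']
  field_simp
  ring

lemma integral_exp_neg_sq_add_mul_sq {l : ℝ} (hl : 0 ≤ l) (y : EuclideanSpace ℝ (Fin N)) :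
    Integrable (fun x : EuclideanSpace ℝ (Fin N) =>
      Real.exp (-‖x‖ ^ 2) * Real.exp (-(‖x + y‖ ^ 2 * l))) ∧
    ∫ x : EuclideanSpace ℝ (Fin N), Real.exp (-‖x‖ ^ 2) * Real.exp (-(‖x + y‖ ^ 2 * l)) =
      (Real.pi / (1 + l)) ^ ((N : ℝ) / 2) * Real.exp (-(l / (1 + l) * ‖y‖ ^ 2)) := by
  have hl1 : 0 < 1 + l := by linarith
  have hsq : ∀ x : EuclideanSpace ℝ (Fin N),
      Real.exp (-‖x‖ ^ 2) * Real.exp (-(‖x + y‖ ^ 2 * l)) =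
      Real.exp (-(1 + l) * ‖x + (l / (1 + l)) • y‖ ^ 2) *
        Real.exp (-(l / (1 + l) * ‖y‖ ^ 2)) := fun x => by
    rw [← Real.exp_add, ← Real.exp_add]
    congr 1
    rw [norm_add_sq_real, norm_add_sq_real, inner_smul_right, norm_smul, Real.norm_eq_abs,
      mul_pow, sq_abs]
    field_simp
    ring
  have hint := GaussianFourier.integral_rexp_neg_mul_sq_norm (V := EuclideanSpace ℝ (Fin N)) hl1
  -- a non-integrable Gaussian would have integral `0`
  have hi : Integrable (fun x : EuclideanSpace ℝ (Fin N) => Real.exp (-(1 + l) * ‖x‖ ^ 2)) := by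
    by_contra hcon
    rw [integral_undef hcon] at hint
    have := Real.pi_pos
    have h : 0 < (Real.pi / (1 + l)) ^
      ((Module.finrank ℝ (EuclideanSpace ℝ (Fin N)) : ℝ) / 2) := by positivity
    linarith
  simp only [hsq]
  refine ⟨(hi.comp_add_right _).mul_const _, ?_⟩
  rw [integral_mul_const, integral_add_right_eq_self (fun x => Real.exp (-(1 + l) * ‖x‖ ^ 2)),
    hint, finrank_euclideanSpace, Fintype.card_fin]

/-! ### The truncated form tested against a Gaussian -/

lemma integrableOn_rpow_mul_pi_div_rpow {b : ℝ} (hb : 0 < b) (hb' : b < (N : ℝ) / 2) :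
    IntegrableOn (fun l : ℝ => l ^ (b - 1) * (Real.pi / (1 + l)) ^ ((N : ℝ) / 2)) (Ioi 0) := by
  have h := (integral_rpow_mul_one_add_rpow hb (sub_pos.2 hb')).1.const_mul
    (Real.pi ^ ((N : ℝ) / 2))
  refine h.congr ((ae_restrict_mem measurableSet_Ioi).mono fun l hl => ?_)
  have hl1 : (0 : ℝ) ≤ 1 + l := by
    have : (0 : ℝ) < l := hl
    linarith
  simp only [add_sub_cancel]
  rw [Real.div_rpow Real.pi_pos.le hl1, Real.rpow_neg hl1]
  ring

lemma integrableOn_rpow_mul_pi_div_rpow_mul_exp {b : ℝ} (hb : 0 < b) (hb' : b < (N : ℝ) / 2)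
    (r : ℝ) :
    IntegrableOn (fun l : ℝ => l ^ (b - 1) * ((Real.pi / (1 + l)) ^ ((N : ℝ) / 2) *
      Real.exp (-(l / (1 + l) * r ^ 2)))) (Ioi 0) := by
  refine Integrable.mono' (integrableOn_rpow_mul_pi_div_rpow hb hb')
    (Measurable.aestronglyMeasurable (by fun_prop))
    ((ae_restrict_mem measurableSet_Ioi).mono fun l hl => ?_)
  have hl0 : (0 : ℝ) < l := hl
  have := Real.pi_pos
  rw [Real.norm_of_nonneg (by positivity)]
  gcongr
  refine mul_le_of_le_one_right (by positivity) (Real.exp_le_one_iff.2 ?_)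
  have : 0 ≤ l / (1 + l) * r ^ 2 := by positivity
  linarith

/-- The convolution of a Gaussian with a negative power of the norm, obtained by writing
`r ^ (-2b)` as a superposition of the Gaussians `e^{-l r²}`. -/
lemma integral_exp_neg_sq_mul_rpow (hN : 1 ≤ N) {b : ℝ} (hb : 0 < b) (hb' : b < (N : ℝ) / 2)
    (y : EuclideanSpace ℝ (Fin N)) :
    Integrable (fun x : EuclideanSpace ℝ (Fin N) =>
      Real.exp (-‖x‖ ^ 2) * ‖x + y‖ ^ (-(2 * b))) ∧
    ∫ x : EuclideanSpace ℝ (Fin N), Real.exp (-‖x‖ ^ 2) * ‖x + y‖ ^ (-(2 * b)) =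
      (Real.Gamma b)⁻¹ * ∫ l in Ioi (0 : ℝ), l ^ (b - 1) *
        ((Real.pi / (1 + l)) ^ ((N : ℝ) / 2) * Real.exp (-(l / (1 + l) * ‖y‖ ^ 2))) := by
  have : Nonempty (Fin N) := ⟨⟨0, hN⟩⟩
  set f : ℝ → EuclideanSpace ℝ (Fin N) → ℝ := fun l x =>
    l ^ (b - 1) * (Real.exp (-‖x‖ ^ 2) * Real.exp (-(‖x + y‖ ^ 2 * l))) with hf
  have hm : Measurable (Function.uncurry f) := by
    unfold f Function.uncurry
    fun_prop
  have hin : ∀ l ∈ Ioi (0 : ℝ), Integrable (f l) ∧ ∫ x, f l x = l ^ (b - 1) *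
      ((Real.pi / (1 + l)) ^ ((N : ℝ) / 2) * Real.exp (-(l / (1 + l) * ‖y‖ ^ 2))) :=
    fun l hl => by
      obtain ⟨h1, h2⟩ := integral_exp_neg_sq_add_mul_sq (le_of_lt hl) y
      exact ⟨h1.const_mul _, by rw [← h2, ← integral_const_mul]⟩
  obtain ⟨h1, h2⟩ := integral_swap_of_nonneg (μ := volume.restrict (Ioi 0)) (ν := volume)
    hm.aestronglyMeasurable
    ((ae_restrict_mem measurableSet_Ioi).mono fun l hl => .of_forall fun x => by
      have hl0 : 0 < l := hl
      simp only [hf]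
      positivity)
    ((ae_restrict_mem measurableSet_Ioi).mono fun l hl => (hin l hl).1)
    ((integrableOn_rpow_mul_pi_div_rpow_mul_exp hb hb' ‖y‖).congr
      ((ae_restrict_mem measurableSet_Ioi).mono fun l hl => (hin l hl).2.symm))
  have hG : Real.Gamma b ≠ 0 := (Real.Gamma_pos_of_pos hb).ne'
  have hae : (fun x => (Real.Gamma b)⁻¹ * ∫ l in Ioi (0 : ℝ), f l x) =ᵐ[volume] fun x =>
      Real.exp (-‖x‖ ^ 2) * ‖x + y‖ ^ (-(2 * b)) := by
    filter_upwards [Measure.ae_ne volume (-y)] with x hx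
    have hx0 : 0 < ‖x + y‖ := norm_pos_iff.2 fun h => hx (eq_neg_of_add_eq_zero_left h)
    have hfx : ∀ l, f l x = Real.exp (-‖x‖ ^ 2) * (l ^ (b - 1) *
        Real.exp (-(‖x + y‖ ^ 2 * l))) := fun l => by
      simp only [hf]
      ring
    simp only [hfx]
    rw [integral_const_mul, Real.integral_rpow_mul_exp_neg_mul_Ioi hb (by positivity), one_div,
      Real.inv_rpow (by positivity), ← Real.rpow_natCast_mul hx0.le, Real.rpow_neg hx0.le]
    push_cast
    field_simp
  refine ⟨(h1.const_mul _).congr hae, ?_⟩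
  rw [← integral_congr_ae hae, integral_const_mul, h2, setIntegral_congr_fun measurableSet_Ioi
    (fun l hl => (hin l hl).2)]

/-- Up to the factor `Γ(b)`, the difference between the convolution of `e^{-|x|²}` with
`|x|^{-2b}` at the origin and at `y`. -/
noncomputable def gaussDefect (b : ℝ) (y : EuclideanSpace ℝ (Fin N)) : ℝ :=
  ∫ l in Ioi (0 : ℝ), l ^ (b - 1) * (Real.pi / (1 + l)) ^ ((N : ℝ) / 2) *
    (1 - Real.exp (-(l / (1 + l) * ‖y‖ ^ 2)))

lemma integral_exp_neg_sq_mul_sub (hN : 1 ≤ N) {b : ℝ} (hb : 0 < b) (hb' : b < (N : ℝ) / 2)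
    (y : EuclideanSpace ℝ (Fin N)) :
    ∫ x : EuclideanSpace ℝ (Fin N),
      Real.exp (-‖x‖ ^ 2) * (‖x‖ ^ (-(2 * b)) - ‖x + y‖ ^ (-(2 * b))) =
      (Real.Gamma b)⁻¹ * gaussDefect b y := by
  obtain ⟨i1, e1⟩ := integral_exp_neg_sq_mul_rpow hN hb hb' (0 : EuclideanSpace ℝ (Fin N))
  obtain ⟨i2, e2⟩ := integral_exp_neg_sq_mul_rpow hN hb hb' y
  simp only [add_zero] at i1 e1
  simp only [mul_sub]
  rw [integral_sub i1 i2, e1, e2, ← mul_sub, ← integral_sub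
    (integrableOn_rpow_mul_pi_div_rpow_mul_exp hb hb' _)
    (integrableOn_rpow_mul_pi_div_rpow_mul_exp hb hb' _), gaussDefect]
  congr 1
  refine integral_congr_ae (.of_forall fun l => ?_)
  simp only [norm_zero]
  rw [zero_pow two_ne_zero, mul_zero, neg_zero, Real.exp_zero]
  ring

lemma integral_gaussDefect_div (hN : 1 ≤ N) (hs : 0 < s) (hs1 : s < 1) {b : ℝ} (hb : 0 < b)
    (hb' : b < (N : ℝ) / 2) :
    Integrable (fun y : EuclideanSpace ℝ (Fin N) =>
      gaussDefect b y / ‖y‖ ^ ((N : ℝ) + 2 * s)) ∧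
    ∫ y : EuclideanSpace ℝ (Fin N), gaussDefect b y / ‖y‖ ^ ((N : ℝ) + 2 * s) =
      Real.pi ^ ((N : ℝ) / 2) * (N * volume.real (ball (0 : EuclideanSpace ℝ (Fin N)) 1) *
        (Real.Gamma (1 - s) / (2 * s))) *
        (Real.Gamma (b + s) * Real.Gamma (N / 2 - b) / Real.Gamma (N / 2 + s)) := by
  set A : ℝ := N * volume.real (ball (0 : EuclideanSpace ℝ (Fin N)) 1) *
        (Real.Gamma (1 - s) / (2 * s)) with hA
  set f : ℝ → EuclideanSpace ℝ (Fin N) → ℝ := fun l y =>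
    l ^ (b - 1) * (Real.pi / (1 + l)) ^ ((N : ℝ) / 2) *
      ((1 - Real.exp (-(l / (1 + l) * ‖y‖ ^ 2))) / ‖y‖ ^ ((N : ℝ) + 2 * s)) with hf
  have hm : Measurable (Function.uncurry f) := by
    unfold f Function.uncurry
    fun_prop
  obtain ⟨ib, eb⟩ := integral_rpow_mul_one_add_rpow (p := b + s) (q := N / 2 - b)
    (by linarith) (by linarith)
  have hin : ∀ l ∈ Ioi (0 : ℝ), Integrable (f l) ∧ ∫ y, f l y =
      Real.pi ^ ((N : ℝ) / 2) * A *
        (l ^ (b + s - 1) * (1 + l) ^ (-(b + s + (N / 2 - b)))) := fun l hl => by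
    have hl0 : 0 < l := hl
    have hl1 : 0 < 1 + l := by linarith
    obtain ⟨h1, h2⟩ := integral_one_sub_exp_div hN hs hs1 (κ := l / (1 + l)) (by positivity)
    refine ⟨h1.const_mul _, ?_⟩
    simp only [hf]
    rw [integral_const_mul, h2, Real.div_rpow Real.pi_pos.le hl1.le, Real.div_rpow hl0.le hl1.le]
    have e1 : l ^ (b + s - 1) = l ^ (b - 1) * l ^ s := by
      rw [← Real.rpow_add hl0]
      ring_nf
    have e2 : (1 + l) ^ (-(b + s + ((N : ℝ) / 2 - b))) =
        ((1 + l) ^ ((N : ℝ) / 2))⁻¹ * ((1 + l) ^ s)⁻¹ := by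
      rw [← Real.rpow_neg hl1.le, ← Real.rpow_neg hl1.le, ← Real.rpow_add hl1]
      ring_nf
    rw [e1, e2]
    ring
  obtain ⟨h1, h2⟩ := integral_swap_of_nonneg (μ := volume.restrict (Ioi 0)) (ν := volume)
    hm.aestronglyMeasurable
    ((ae_restrict_mem measurableSet_Ioi).mono fun l hl => .of_forall fun y => by
      have hl0 : 0 < l := hl
      have := Real.pi_pos
      have : 0 ≤ l / (1 + l) * ‖y‖ ^ 2 := by positivity
      have h0 : 0 ≤ 1 - Real.exp (-(l / (1 + l) * ‖y‖ ^ 2)) :=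
        sub_nonneg.2 (Real.exp_le_one_iff.2 (by linarith))
      simp only [hf]
      positivity)
    ((ae_restrict_mem measurableSet_Ioi).mono fun l hl => (hin l hl).1)
    ((ib.const_mul _).congr ((ae_restrict_mem measurableSet_Ioi).mono
      fun l hl => (hin l hl).2.symm))
  have hout : ∀ y, ∫ l in Ioi (0 : ℝ), f l y = gaussDefect b y / ‖y‖ ^ ((N : ℝ) + 2 * s) :=
    fun y => by
      rw [gaussDefect, ← integral_div]
      exact integral_congr_ae (.of_forall fun l => by simp only [hf]; ring)
  simp only [hout] at h1 h2
  refine ⟨h1, h2.trans ?_⟩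
  rw [setIntegral_congr_fun measurableSet_Ioi (fun l hl => (hin l hl).2), integral_const_mul, eb]
  have : b + s + ((N : ℝ) / 2 - b) = N / 2 + s := by ring
  rw [this]

lemma integrable_indicator_inv_norm_rpow (hN : 1 ≤ N) (hs : 0 < s) {ε : ℝ} (hε : 0 < ε) :
    Integrable ((ball (0 : EuclideanSpace ℝ (Fin N)) ε)ᶜ.indicator
      fun y => (‖y‖ ^ ((N : ℝ) + 2 * s))⁻¹) := by
  have : Nonempty (Fin N) := ⟨⟨0, hN⟩⟩
  obtain ⟨e, he⟩ : ∃ e : EuclideanSpace ℝ (Fin N), ‖e‖ = 1 := exists_norm_eq _ zero_le_one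
  have h := integrableOn_div_norm_sub_rpow (u := fun _ => 1) hs
    ((integrable_norm_rpow_div hN (γ := 0) (s := s) (by simp; omega) (by linarith)).congr
      (.of_forall fun z => by simp)) he hε
  rw [← integrable_indicator_iff measurableSet_ball.compl] at h
  refine (integrable_comp_sub_left _ e).1 (h.congr (.of_forall fun z => ?_))
  beta_reduce
  by_cases hz : z ∈ (ball e ε)ᶜ
  · have : e - z ∈ (ball (0 : EuclideanSpace ℝ (Fin N)) ε)ᶜ := by
      simpa [dist_eq_norm, norm_sub_rev] using hz
    rw [indicator_of_mem hz, indicator_of_mem this, one_div]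
  · have : e - z ∉ (ball (0 : EuclideanSpace ℝ (Fin N)) ε)ᶜ := by
      simpa [dist_eq_norm, norm_sub_rev] using hz
    rw [indicator_of_notMem hz, indicator_of_notMem this]

/-- The integral defining `(-Δ)^s |x|^a` at a unit vector `e`, up to the normalization constant,
truncated at distance `ε` from `e`. -/
noncomputable def truncPow (s : ℝ) (e : EuclideanSpace ℝ (Fin N)) (a ε : ℝ) : ℝ :=
  ∫ z in (ball e ε)ᶜ, (1 - ‖z‖ ^ a) / ‖e - z‖ ^ ((N : ℝ) + 2 * s)

/-- The truncated integral at `x ≠ 0` scales to the one at a unit vector. -/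
lemma integral_sub_mul_indicator {a : ℝ} {e : EuclideanSpace ℝ (Fin N)}
    (he : ‖e‖ = 1) {x : EuclideanSpace ℝ (Fin N)} (hx : x ≠ 0) (ε : ℝ) :
    ∫ y : EuclideanSpace ℝ (Fin N), (‖x‖ ^ a - ‖x + y‖ ^ a) *
      (ball (0 : EuclideanSpace ℝ (Fin N)) ε)ᶜ.indicator (fun y => (‖y‖ ^ ((N : ℝ) + 2 * s))⁻¹) y =
      ‖x‖ ^ (a - 2 * s) * truncPow s e a (ε / ‖x‖) := by
  have hρ : 0 < ‖x‖ := norm_pos_iff.2 hx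
  obtain ⟨R, hR⟩ := exists_linearIsometryEquiv_apply_eq he hx
  set g : EuclideanSpace ℝ (Fin N) → ℝ := (ball x ε)ᶜ.indicator
    fun z => (‖x‖ ^ a - ‖z‖ ^ a) / ‖x - z‖ ^ ((N : ℝ) + 2 * s) with hg
  have h1 : ∀ y, (‖x‖ ^ a - ‖x + y‖ ^ a) * (ball (0 : EuclideanSpace ℝ (Fin N)) ε)ᶜ.indicator
      (fun y => (‖y‖ ^ ((N : ℝ) + 2 * s))⁻¹) y = g (x + y) := fun y => by
    by_cases hy : y ∈ (ball (0 : EuclideanSpace ℝ (Fin N)) ε)ᶜ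
    · have : x + y ∈ (ball x ε)ᶜ := by simpa using hy
      rw [hg, indicator_of_mem hy, indicator_of_mem this, sub_add_cancel_left, norm_neg,
        div_eq_mul_inv]
    · have : x + y ∉ (ball x ε)ᶜ := by simpa using hy
      rw [hg, indicator_of_notMem hy, indicator_of_notMem this, mul_zero]
  have h2 := (truncated_comp_smul_isometry (s := s) hρ R (fun z => ‖z‖ ^ a) e ε).2
  simp only [hR] at h2
  simp only [h1]
  rw [integral_add_left_eq_self g x, hg, integral_indicator measurableSet_ball.compl, h2, truncPow,
    ← integral_const_mul, ← integral_const_mul]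
  refine integral_congr_ae (.of_forall fun w => ?_)
  simp only
  rw [norm_smul, norm_norm, R.norm_map, Real.mul_rpow hρ.le (norm_nonneg _), Real.rpow_sub hρ,
    Real.rpow_neg hρ.le]
  ring

/-- The truncated form `∬ v(x) (u(x) - u(z)) |x - z|^{-(N+2s)}` over `|x - z| ≥ ε`, for
`v = e^{-|x|²}` and `u = |x|^{-2b}`, computed in the two orders of integration. -/
lemma integral_exp_mul_truncPow (hN : 1 ≤ N) (hs : 0 < s) {b : ℝ} (hb : 0 < b)
    (hb' : b < (N : ℝ) / 2) {e : EuclideanSpace ℝ (Fin N)} (he : ‖e‖ = 1) {ε : ℝ} (hε : 0 < ε) :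
    Integrable (fun x : EuclideanSpace ℝ (Fin N) => Real.exp (-‖x‖ ^ 2) *
      (‖x‖ ^ (-(2 * b) - 2 * s) * truncPow s e (-(2 * b)) (ε / ‖x‖))) ∧
    ∫ x : EuclideanSpace ℝ (Fin N), Real.exp (-‖x‖ ^ 2) *
      (‖x‖ ^ (-(2 * b) - 2 * s) * truncPow s e (-(2 * b)) (ε / ‖x‖)) =
    (Real.Gamma b)⁻¹ * ∫ y in (ball (0 : EuclideanSpace ℝ (Fin N)) ε)ᶜ,
      gaussDefect b y / ‖y‖ ^ ((N : ℝ) + 2 * s) := by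
  have : Nonempty (Fin N) := ⟨⟨0, hN⟩⟩
  set a : ℝ := -(2 * b) with ha
  set k : EuclideanSpace ℝ (Fin N) → ℝ := (ball (0 : EuclideanSpace ℝ (Fin N)) ε)ᶜ.indicator
      (fun y => (‖y‖ ^ ((N : ℝ) + 2 * s))⁻¹) with hk
  have hk0 : ∀ y, 0 ≤ k y := fun y => indicator_nonneg (fun y _ => by positivity) y
  have hkm : Measurable k :=
    (by fun_prop : Measurable fun y : EuclideanSpace ℝ (Fin N) =>
      (‖y‖ ^ ((N : ℝ) + 2 * s))⁻¹).indicator measurableSet_ball.compl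
  have hki : Integrable k := integrable_indicator_inv_norm_rpow hN hs hε
  have hconv := integral_exp_neg_sq_mul_rpow hN hb hb'
  obtain ⟨i0, -⟩ := hconv 0
  simp only [add_zero] at i0
  have hf1 : Integrable (fun q : EuclideanSpace ℝ (Fin N) × EuclideanSpace ℝ (Fin N) =>
      (Real.exp (-‖q.1‖ ^ 2) * ‖q.1‖ ^ a) * k q.2) (volume.prod volume) := i0.mul_prod hki
  have hf2 : Integrable (fun q : EuclideanSpace ℝ (Fin N) × EuclideanSpace ℝ (Fin N) =>
      (Real.exp (-‖q.1‖ ^ 2) * ‖q.1 + q.2‖ ^ a) * k q.2) (volume.prod volume) := by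
    have hm : Measurable (fun q : EuclideanSpace ℝ (Fin N) × EuclideanSpace ℝ (Fin N) =>
        (Real.exp (-‖q.1‖ ^ 2) * ‖q.1 + q.2‖ ^ a) * k q.2) := by
      fun_prop
    refine (integrable_prod_iff' hm.aestronglyMeasurable).2
      ⟨.of_forall fun y => ((hconv y).1).mul_const (k y), ?_⟩
    have hn : ∀ x y : EuclideanSpace ℝ (Fin N),
        ‖(Real.exp (-‖x‖ ^ 2) * ‖x + y‖ ^ a) * k y‖ =
        (Real.exp (-‖x‖ ^ 2) * ‖x + y‖ ^ a) * k y := fun x y =>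
      Real.norm_of_nonneg (mul_nonneg (by positivity) (hk0 _))
    refine Integrable.mono' (hki.const_mul ((Real.Gamma b)⁻¹ * ∫ l in Ioi (0 : ℝ), l ^ (b - 1) *
        (Real.pi / (1 + l)) ^ ((N : ℝ) / 2)))
      (hm.norm.stronglyMeasurable.integral_prod_left' (μ := volume)).aestronglyMeasurable
      (.of_forall fun y => ?_)
    simp only [hn]
    rw [integral_mul_const, (hconv y).2, Real.norm_of_nonneg]
    · refine mul_le_mul_of_nonneg_right ?_ (hk0 y)
      refine mul_le_mul_of_nonneg_left ?_ (inv_nonneg.2 (Real.Gamma_pos_of_pos hb).le)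
      refine setIntegral_mono_on (integrableOn_rpow_mul_pi_div_rpow_mul_exp hb hb' _)
        (integrableOn_rpow_mul_pi_div_rpow hb hb') measurableSet_Ioi fun l hl => ?_
      have hl0 : (0 : ℝ) < l := hl
      have := Real.pi_pos
      gcongr
      refine mul_le_of_le_one_right (by positivity) (Real.exp_le_one_iff.2 ?_)
      have : 0 ≤ l / (1 + l) * ‖y‖ ^ 2 := by positivity
      linarith
    · rw [← (hconv y).2]
      exact mul_nonneg (integral_nonneg fun x => by positivity) (hk0 y)
  set f : EuclideanSpace ℝ (Fin N) → EuclideanSpace ℝ (Fin N) → ℝ := fun x y =>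
    Real.exp (-‖x‖ ^ 2) * ((‖x‖ ^ a - ‖x + y‖ ^ a) * k y) with hf
  have hfi : Integrable (Function.uncurry f) (volume.prod volume) := by
    refine (hf1.sub hf2).congr (.of_forall fun q => ?_)
    simp only [Pi.sub_apply, Function.uncurry, hf]
    ring
  have hx : (fun x => ∫ y, f x y) =ᵐ[volume] fun x : EuclideanSpace ℝ (Fin N) =>
      Real.exp (-‖x‖ ^ 2) * (‖x‖ ^ (a - 2 * s) * truncPow s e a (ε / ‖x‖)) := by
    filter_upwards [Measure.ae_ne volume (0 : EuclideanSpace ℝ (Fin N))] with x hx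
    simp only [hf]
    rw [integral_const_mul, integral_sub_mul_indicator he hx]
  have hy : ∀ y, ∫ x, f x y = (Real.Gamma b)⁻¹ *
      (ball (0 : EuclideanSpace ℝ (Fin N)) ε)ᶜ.indicator
        (fun y => gaussDefect b y / ‖y‖ ^ ((N : ℝ) + 2 * s)) y := fun y => by
    simp only [hf, ← mul_assoc]
    rw [integral_mul_const, integral_exp_neg_sq_mul_sub hN hb hb' y, mul_assoc]
    congr 1
    by_cases h : y ∈ (ball (0 : EuclideanSpace ℝ (Fin N)) ε)ᶜ
    · rw [hk, indicator_of_mem h, indicator_of_mem h, div_eq_mul_inv]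
    · rw [hk, indicator_of_notMem h, indicator_of_notMem h, mul_zero]
  refine ⟨hfi.integral_prod_left.congr hx, ?_⟩
  rw [← integral_congr_ae hx, integral_integral_swap hfi]
  simp only [hy]
  rw [integral_const_mul, integral_indicator measurableSet_ball.compl]

/-! ### The critical value, inversion of the symbol, and the equation -/

lemma tendsto_truncPow (hN : 2 ≤ N) (hs : 0 < s) (hs1 : s < 1) {τ : ℝ}
    (h1 : -(N : ℝ) < τ) (h2 : τ < 2 * s) {e : EuclideanSpace ℝ (Fin N)} (he : ‖e‖ = 1) :
    Tendsto (truncPow s e τ) (𝓝[>] 0) (𝓝 (extIntegral s e (powBracket N s τ))) := by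
  have hC := (normConst_pos (N := N) hs hs1).ne'
  have h := ((hasFracLaplacianAt_rpow_of_norm_eq_one hN hs hs1 h1 h2 he).2).const_mul
    (normConst N s)⁻¹
  simp only [he, Real.one_rpow, symbol, inv_mul_cancel_left₀ hC] at h
  exact h

/-- The truncated integrals are bounded uniformly in the truncation, which dominates the passage to
the limit under the Gaussian weight. -/
lemma exists_abs_truncPow_le (hN : 2 ≤ N) (hs : 0 < s) (hs1 : s < 1) {τ : ℝ}
    (h1 : -(N : ℝ) < τ) (h2 : τ < 2 * s) {e : EuclideanSpace ℝ (Fin N)} (he : ‖e‖ = 1) :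
    ∃ M : ℝ, ∀ ε, 0 < ε → |truncPow s e τ ε| ≤ M := by
  set c : ℝ := extIntegral s e (powBracket N s τ) with hc
  have hev : ∀ᶠ ε in 𝓝[>] (0 : ℝ), |truncPow s e τ ε| < |c| + 1 :=
    (tendsto_truncPow hN hs hs1 h1 h2 he).abs.eventually (eventually_lt_nhds (by linarith))
  obtain ⟨δ, hδ, hsub⟩ := mem_nhdsGT_iff_exists_Ioo_subset.1 hev
  have hδ0 : 0 < δ := hδ
  have hi := integrableOn_sub_div (by omega) hs
    (integrable_norm_rpow_div (N := N) (s := s) (by omega) h1 h2) 1 he hδ0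
  refine ⟨max (|c| + 1) (∫ z in (ball e δ)ᶜ, ‖(1 - ‖z‖ ^ τ) / ‖e - z‖ ^ ((N : ℝ) + 2 * s)‖),
    fun ε hε => ?_⟩
  rcases lt_or_ge ε δ with h | h
  · exact (le_of_lt (hsub ⟨hε, h⟩)).trans (le_max_left _ _)
  · refine le_trans ?_ (le_max_right _ _)
    refine (norm_integral_le_integral_norm
      (fun z : EuclideanSpace ℝ (Fin N) => (1 - ‖z‖ ^ τ) / ‖e - z‖ ^ ((N : ℝ) + 2 * s))).trans ?_
    exact setIntegral_mono_set hi.norm (.of_forall fun z => norm_nonneg _)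
      (LE.le.eventuallyLE (compl_subset_compl.2 (ball_subset_ball h)))

/-- The value of `c` at `(2s - N)/2` is the best constant of the fractional Hardy inequality. -/
theorem symbol_critical (hN : 2 ≤ N) (hs : 0 < s) (hs1 : s < 1)
    {e : EuclideanSpace ℝ (Fin N)} (he : ‖e‖ = 1) :
    symbol s e ((2 * s - N) / 2) = -criticalMu N s := by
  have hN' : (2 : ℝ) ≤ N := by exact_mod_cast hN
  have : Nonempty (Fin N) := ⟨⟨0, by omega⟩⟩
  set b : ℝ := ((N : ℝ) - 2 * s) / 4 with hb
  have hb0 : 0 < b := by rw [hb]; linarith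
  have hb1 : b < (N : ℝ) / 2 := by rw [hb]; linarith
  have ha : (2 * s - N) / 2 = -(2 * b) := by rw [hb]; ring
  have h1 : -(N : ℝ) < -(2 * b) := by linarith
  have h2 : -(2 * b) < 2 * s := by linarith
  rw [ha]
  set c : ℝ := extIntegral s e (powBracket N s (-(2 * b))) with hc
  obtain ⟨M, hM⟩ := exists_abs_truncPow_le hN hs hs1 h1 h2 he
  obtain ⟨iG, eG⟩ := integral_norm_rpow_mul_exp (N := N) (by omega) (q := -(2 * b) - 2 * s)
    (κ := 1) (by rw [hb]; linarith) one_pos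
  obtain ⟨iD, eD⟩ := integral_gaussDefect_div (N := N) (by omega) hs hs1 hb0 hb1
  simp only [one_mul] at iG eG
  have hlim1 : Tendsto (fun ε : ℝ => ∫ x : EuclideanSpace ℝ (Fin N), Real.exp (-‖x‖ ^ 2) *
      (‖x‖ ^ (-(2 * b) - 2 * s) * truncPow s e (-(2 * b)) (ε / ‖x‖))) (𝓝[>] 0)
      (𝓝 (∫ x : EuclideanSpace ℝ (Fin N), Real.exp (-‖x‖ ^ 2) *
        (‖x‖ ^ (-(2 * b) - 2 * s) * c))) := by
    refine tendsto_integral_filter_of_dominated_convergence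
      (fun x => ‖x‖ ^ (-(2 * b) - 2 * s) * Real.exp (-‖x‖ ^ 2) * M) ?_ ?_ (iG.mul_const M) ?_
    · filter_upwards [self_mem_nhdsWithin] with ε hε
      exact (integral_exp_mul_truncPow (by omega) hs hb0 hb1 he hε).1.1
    · filter_upwards [self_mem_nhdsWithin] with ε hε
      filter_upwards [Measure.ae_ne volume (0 : EuclideanSpace ℝ (Fin N))] with x hx
      have hx0 : 0 < ‖x‖ := norm_pos_iff.2 hx
      rw [← mul_assoc, norm_mul, Real.norm_of_nonneg (by positivity), mul_comm (Real.exp _)]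
      gcongr
      exact hM _ (div_pos hε hx0)
    · filter_upwards [Measure.ae_ne volume (0 : EuclideanSpace ℝ (Fin N))] with x hx
      have hx0 : 0 < ‖x‖ := norm_pos_iff.2 hx
      have hdiv : Tendsto (fun ε : ℝ => ε / ‖x‖) (𝓝[>] 0) (𝓝[>] 0) := by
        refine tendsto_nhdsWithin_iff.2 ⟨?_, ?_⟩
        · have : Tendsto (fun ε : ℝ => ε / ‖x‖) (𝓝 0) (𝓝 (0 / ‖x‖)) := tendsto_id.div_const ‖x‖
          rw [zero_div] at this
          exact this.mono_left nhdsWithin_le_nhds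
        · filter_upwards [self_mem_nhdsWithin] with ε hε
          exact div_pos hε hx0
      exact (((tendsto_truncPow hN hs hs1 h1 h2 he).comp hdiv).const_mul _).const_mul _
  have hlim2 : Tendsto (fun ε : ℝ => (Real.Gamma b)⁻¹ *
      ∫ y in (ball (0 : EuclideanSpace ℝ (Fin N)) ε)ᶜ,
        gaussDefect b y / ‖y‖ ^ ((N : ℝ) + 2 * s)) (𝓝[>] 0)
      (𝓝 ((Real.Gamma b)⁻¹ * ∫ y : EuclideanSpace ℝ (Fin N),
        gaussDefect b y / ‖y‖ ^ ((N : ℝ) + 2 * s))) := by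
    refine Tendsto.const_mul _ ?_
    simp only [← integral_indicator measurableSet_ball.compl]
    refine tendsto_integral_filter_of_dominated_convergence
      (fun y => ‖gaussDefect b y / ‖y‖ ^ ((N : ℝ) + 2 * s)‖)
      (.of_forall fun ε => iD.1.indicator measurableSet_ball.compl)
      (.of_forall fun ε => .of_forall fun y => norm_indicator_le_norm_self _ _) iD.norm ?_
    filter_upwards [Measure.ae_ne volume (0 : EuclideanSpace ℝ (Fin N))] with y hy
    have hy0 : 0 < ‖y‖ := norm_pos_iff.2 hy
    refine tendsto_const_nhds.congr' ?_
    filter_upwards [Ioo_mem_nhdsGT hy0] with ε hε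
    rw [indicator_of_mem]
    simpa using hε.2.le
  have heq := tendsto_nhds_unique hlim1 (hlim2.congr' (by
    filter_upwards [self_mem_nhdsWithin] with ε hε
    exact (integral_exp_mul_truncPow (by omega) hs hb0 hb1 he hε).2.symm))
  have hl : ∫ x : EuclideanSpace ℝ (Fin N), Real.exp (-‖x‖ ^ 2) *
      (‖x‖ ^ (-(2 * b) - 2 * s) * c) = c * ∫ x : EuclideanSpace ℝ (Fin N),
        ‖x‖ ^ (-(2 * b) - 2 * s) * Real.exp (-‖x‖ ^ 2) := by
    rw [← integral_const_mul]
    exact integral_congr_ae (.of_forall fun x => by simp only; ring)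
  rw [hl, eG, eD] at heq
  have e1 : ((N : ℝ) + (-(2 * b) - 2 * s)) / 2 = b := by rw [hb]; ring
  have e2 : (N : ℝ) / 2 - b = b + s := by rw [hb]; ring
  have e3 : b + s = ((N : ℝ) + 2 * s) / 4 := by rw [hb]; ring
  have e4 : (N : ℝ) / 2 + s = ((N : ℝ) + 2 * s) / 2 := by ring
  rw [e1, e2, Real.one_rpow, e3, e4] at heq
  have hV : 0 < volume.real (ball (0 : EuclideanSpace ℝ (Fin N)) 1) :=
    ENNReal.toReal_pos (measure_ball_pos _ _ one_pos).ne' measure_ball_lt_top.ne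
  have g1 : 0 < Real.Gamma b := Real.Gamma_pos_of_pos hb0
  have g2 : 0 < Real.Gamma (((N : ℝ) + 2 * s) / 2) := Real.Gamma_pos_of_pos (by positivity)
  have g3 : 0 < Real.Gamma (1 - s) := Real.Gamma_pos_of_pos (by linarith)
  have hcval : c = Real.pi ^ ((N : ℝ) / 2) * (Real.Gamma (1 - s) / s) *
      (Real.Gamma (((N : ℝ) + 2 * s) / 4) * Real.Gamma (((N : ℝ) + 2 * s) / 4) /
        Real.Gamma (((N : ℝ) + 2 * s) / 2)) / Real.Gamma b ^ 2 := by
    field_simp at heq ⊢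
    linarith
  have hpi : 0 < Real.pi ^ ((N : ℝ) / 2) := Real.rpow_pos_of_pos Real.pi_pos _
  rw [symbol, ← hc, hcval, normConst, criticalMu, Real.rpow_neg Real.pi_pos.le, ← hb]
  field_simp

lemma criticalMu_neg (hN : 2 ≤ N) (hs : 0 < s) (hs1 : s < 1) : criticalMu N s < 0 := by
  have hN' : (2 : ℝ) ≤ N := by exact_mod_cast hN
  have h1 : 0 < Real.Gamma (((N : ℝ) + 2 * s) / 4) := Real.Gamma_pos_of_pos (by positivity)
  have h2 : 0 < Real.Gamma (((N : ℝ) - 2 * s) / 4) := Real.Gamma_pos_of_pos (by linarith)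
  rw [criticalMu, neg_lt_zero]
  positivity

/-- A continuous strictly increasing function on `[a, b)` which tends to `+∞` at `b` has a
continuous strictly increasing inverse on `[Ψ a, ∞)`, which tends to `b` at `+∞`. -/
lemma exists_continuousOn_strictMonoOn_inverse {a b : ℝ} (hab : a < b) {Ψ : ℝ → ℝ}
    (hc : ContinuousOn Ψ (Ico a b)) (hm : StrictMonoOn Ψ (Ico a b))
    (ht : Tendsto Ψ (𝓝[<] b) atTop) :
    ∃ T : ℝ → ℝ, (∀ μ, Ψ a ≤ μ → T μ ∈ Ico a b ∧ Ψ (T μ) = μ) ∧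
      ContinuousOn T (Ici (Ψ a)) ∧ StrictMonoOn T (Ici (Ψ a)) ∧ Tendsto T atTop (𝓝 b) := by
  have hsurj : ∀ μ, Ψ a ≤ μ → ∃ τ, τ ∈ Ico a b ∧ Ψ τ = μ := fun μ hμ => by
    obtain ⟨c, hc1, hc2⟩ := ((ht.eventually_ge_atTop μ).and (Ioo_mem_nhdsLT hab)).exists
    obtain ⟨τ, hτ, h⟩ := intermediate_value_Icc hc2.1.le
      (hc.mono fun x hx => ⟨hx.1, hx.2.trans_lt hc2.2⟩) ⟨hμ, hc1⟩
    exact ⟨τ, ⟨hτ.1, hτ.2.trans_lt hc2.2⟩, h⟩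
  choose! T hT using hsurj
  have hmono : StrictMonoOn T (Ici (Ψ a)) := fun μ hμ ν hν h => by
    rwa [← hm.lt_iff_lt (hT μ hμ).1 (hT ν hν).1, (hT μ hμ).2, (hT ν hν).2]
  have hge : ∀ τ ∈ Ico a b, Ψ a ≤ Ψ τ := fun τ hτ =>
    (hm.le_iff_le ⟨le_rfl, hab⟩ hτ).2 hτ.1
  refine ⟨T, hT, ?_, hmono, ?_⟩
  · -- an order isomorphism of intervals is a homeomorphism
    set f : Ici (Ψ a) → Ico a b := fun μ => ⟨T μ, (hT μ μ.2).1⟩ with hf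
    have hfm : StrictMono f := fun μ ν h => hmono μ.2 ν.2 h
    have hfs : Function.Surjective f := fun τ => by
      refine ⟨⟨Ψ τ, hge τ τ.2⟩, Subtype.ext ?_⟩
      exact hm.injOn (hT _ (hge τ τ.2)).1 τ.2 (hT _ (hge τ τ.2)).2
    have hcont : Continuous f := (StrictMono.orderIsoOfSurjective f hfm hfs).continuous
    rw [continuousOn_iff_continuous_domRestrict]
    exact continuous_subtype_val.comp hcont
  · refine tendsto_order.2 ⟨fun c hcb => ?_, fun c hbc => ?_⟩
    · have hd : max c a ∈ Ico a b := ⟨le_max_right _ _, max_lt hcb hab⟩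
      filter_upwards [eventually_gt_atTop (Ψ (max c a))] with μ hμ
      have hμ' := (hge _ hd).trans hμ.le
      refine (le_max_left c a).trans_lt ?_
      rwa [← hm.lt_iff_lt hd (hT μ hμ').1, (hT μ hμ').2]
    · filter_upwards [eventually_ge_atTop (Ψ a)] with μ hμ
      exact (hT μ hμ).1.2.trans hbc

lemma solvesHardy_rpow_iff (hN : 2 ≤ N) (hs : 0 < s) (hs1 : s < 1) {τ : ℝ}
    (h1 : -(N : ℝ) < τ) (h2 : τ < 2 * s) {e : EuclideanSpace ℝ (Fin N)} (he : ‖e‖ = 1) (μ : ℝ) :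
    SolvesHardy s μ (Gam N τ) ↔ -symbol s e τ = μ := by
  constructor
  · intro h
    have he0 : e ≠ 0 := by
      rintro rfl
      simp at he
    obtain ⟨l, hl, heq⟩ := h e he0
    rw [hl.unique (hasFracLaplacianAt_rpow_of_norm_eq_one hN hs hs1 h1 h2 he)] at heq
    simp only [Gam, he, Real.one_rpow, div_one, mul_one] at heq
    linarith
  · rintro rfl x hx
    have hx0 : 0 < ‖x‖ := norm_pos_iff.2 hx
    refine ⟨_, hasFracLaplacianAt_rpow hN hs hs1 h1 h2 he hx, ?_⟩
    rw [Gam, Real.rpow_sub hx0]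
    ring

lemma solvesHardy_rpow_mul_log (hN : 2 ≤ N) (hs : 0 < s) (hs1 : s < 1) :
    SolvesHardy s (criticalMu N s) (Phi N s (criticalMu N s) ((2 * s - N) / 2)) := by
  have : Nonempty (Fin N) := ⟨⟨0, by omega⟩⟩
  obtain ⟨e, he⟩ : ∃ e : EuclideanSpace ℝ (Fin N), ‖e‖ = 1 := exists_norm_eq _ zero_le_one
  intro x hx
  have hx0 : 0 < ‖x‖ := norm_pos_iff.2 hx
  have hPhi : (Phi N s (criticalMu N s) ((2 * s - N) / 2)) =
      fun x => -(‖x‖ ^ ((2 * s - (N : ℝ)) / 2) * Real.log ‖x‖) := by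
    funext x
    rw [Phi, if_pos rfl]
  rw [hPhi]
  refine ⟨_, hasFracLaplacianAt_rpow_mul_log hN hs hs1 rfl he hx, ?_⟩
  rw [symbol_critical hN hs hs1 he, Real.rpow_sub hx0]
  ring

/-- For `τ` below `(2s - N)/2` the logarithmic profile leaves a nonzero term, already at the unit
vectors, where `log |x|` vanishes. -/
lemma eq_of_solvesHardy_rpow_mul_log (hN : 2 ≤ N) (hs : 0 < s) (hs1 : s < 1) {τ : ℝ}
    (h1 : -(N : ℝ) < τ) (h2 : τ ≤ (2 * s - N) / 2)
    (h : SolvesHardy s (criticalMu N s) (Phi N s (criticalMu N s) τ)) :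
    τ = (2 * s - N) / 2 := by
  have hN' : (2 : ℝ) ≤ N := by exact_mod_cast hN
  have : Nonempty (Fin N) := ⟨⟨0, by omega⟩⟩
  obtain ⟨e, he⟩ : ∃ e : EuclideanSpace ℝ (Fin N), ‖e‖ = 1 := exists_norm_eq _ zero_le_one
  have he0 : e ≠ 0 := by
    rintro rfl
    simp at he
  by_contra hne
  have hpos := extIntegral_logBracket_pos hN hs hs1 he h1 (lt_of_le_of_ne h2 hne)
  have hlog := hasFracLaplacianAt_rpow_mul_log_of_norm_eq_one hN hs hs1 h1 (by linarith) he
  have hlog' := hlog.linear_combination hlog (-1) 0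
  have hPhi : (Phi N s (criticalMu N s) τ) =
      fun x => -1 * (‖x‖ ^ τ * Real.log ‖x‖) + 0 * (‖x‖ ^ τ * Real.log ‖x‖) := by
    funext x
    rw [Phi, if_pos rfl]
    ring
  obtain ⟨l, hl, heq⟩ := h e he0
  rw [hPhi] at hl heq
  rw [hl.unique hlog'] at heq
  simp only [he, Real.log_one, mul_zero, zero_mul, add_zero] at heq
  have := mul_pos (normConst_pos (N := N) hs hs1) hpos
  linarith

lemma isAdmissible_rpow (hN : 1 ≤ N) {τ : ℝ} (h1 : -(N : ℝ) < τ) (h2 : τ < 2 * s) :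
    IsAdmissible s (Gam N τ) := by
  refine ⟨integrable_norm_rpow_div hN h1 h2, fun x hx => ?_⟩
  exact ((contDiffAt_norm ℝ hx).rpow_const_of_ne (norm_ne_zero_iff.2 hx)).contDiffWithinAt

lemma isAdmissible_rpow_mul_log (hN : 1 ≤ N) {τ : ℝ} (h1 : -(N : ℝ) < τ) (h2 : τ < 2 * s) :
    IsAdmissible s (Phi N s (criticalMu N s) τ) := by
  have hPhi : (Phi N s (criticalMu N s) τ) = fun x => -(‖x‖ ^ τ * Real.log ‖x‖) := by
    funext x
    rw [Phi, if_pos rfl]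
  rw [hPhi]
  refine ⟨(integrable_norm_rpow_mul_log_div hN h1 h2).neg.congr
    (.of_forall fun x => by simp only [Pi.neg_apply]; ring), fun x hx => ?_⟩
  have hx0 := norm_ne_zero_iff.2 hx
  have hn := contDiffAt_norm (n := ∞) ℝ hx
  exact ((hn.rpow_const_of_ne hx0).mul (hn.log hx0)).neg.contDiffWithinAt

end FracHardy

open FracHardy in
theorem proposition1p2 (N : ℕ) (hN : 2 ≤ N) (s : ℝ) (hs0 : 0 < s) (hs1 : s < 1) :
    ∃ τm τp : ℝ → ℝ,
      -- existence and uniqueness of the exponents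
      (∀ μ : ℝ, FracHardy.criticalMu N s ≤ μ →
        (τm μ ∈ Set.Ioc (-(N : ℝ)) ((2 * s - N) / 2) ∧
          FracHardy.IsAdmissible s (FracHardy.Phi N s μ (τm μ)) ∧
          FracHardy.SolvesHardy s μ (FracHardy.Phi N s μ (τm μ)) ∧
          ∀ τ ∈ Set.Ioc (-(N : ℝ)) ((2 * s - N) / 2),
            FracHardy.SolvesHardy s μ (FracHardy.Phi N s μ τ) → τ = τm μ) ∧
        (τp μ ∈ Set.Ico ((2 * s - N) / 2) (2 * s) ∧
          FracHardy.IsAdmissible s (FracHardy.Gam N (τp μ)) ∧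
          FracHardy.SolvesHardy s μ (FracHardy.Gam N (τp μ)) ∧
          ∀ τ ∈ Set.Ico ((2 * s - N) / 2) (2 * s),
            FracHardy.SolvesHardy s μ (FracHardy.Gam N τ) → τ = τp μ)) ∧
      -- continuity and strict monotonicity
      ContinuousOn τm (Set.Ici (FracHardy.criticalMu N s)) ∧
      StrictAntiOn τm (Set.Ici (FracHardy.criticalMu N s)) ∧
      ContinuousOn τp (Set.Ici (FracHardy.criticalMu N s)) ∧
      StrictMonoOn τp (Set.Ici (FracHardy.criticalMu N s)) ∧
      -- sum, special values and limits
      (∀ μ : ℝ, FracHardy.criticalMu N s ≤ μ → τm μ + τp μ = 2 * s - N) ∧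
      τm (FracHardy.criticalMu N s) = (2 * s - N) / 2 ∧
      τp (FracHardy.criticalMu N s) = (2 * s - N) / 2 ∧
      FracHardy.criticalMu N s < 0 ∧
      τm 0 = 2 * s - N ∧
      τp 0 = 0 ∧
      Filter.Tendsto τm Filter.atTop (nhds (-(N : ℝ))) ∧
      Filter.Tendsto τp Filter.atTop (nhds (2 * s)) := by
  have hN' : (2 : ℝ) ≤ N := by exact_mod_cast hN
  have hne : Nonempty (Fin N) := ⟨⟨0, by omega⟩⟩
  obtain ⟨e, he⟩ : ∃ e : EuclideanSpace ℝ (Fin N), ‖e‖ = 1 := exists_norm_eq _ zero_le_one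
  have hsub : Set.Ico ((2 * s - N) / 2) (2 * s) ⊆ Set.Ioo (-(N : ℝ)) (2 * s) :=
    fun τ hτ => ⟨by linarith [hτ.1], hτ.2⟩
  obtain ⟨T, hT, hTc, hTm, hTl⟩ := exists_continuousOn_strictMonoOn_inverse
    (a := (2 * s - N) / 2) (b := 2 * s) (Ψ := fun τ => -symbol s e τ) (by linarith)
    ((continuousOn_symbol hN hs0 hs1 he).neg.mono hsub)
    (fun τ hτ τ' hτ' h => neg_lt_neg (symbol_lt hN hs0 hs1 he hτ.1 h hτ'.2))
    (Filter.tendsto_neg_atBot_atTop.comp (tendsto_symbol_atBot hN hs0 hs1 he))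
  have hinj : ∀ τ ∈ Set.Ico ((2 * s - N) / 2) (2 * s), ∀ τ' ∈ Set.Ico ((2 * s - N) / 2) (2 * s),
      symbol s e τ = symbol s e τ' → τ = τ' := fun τ hτ τ' hτ' h => by
    rcases lt_trichotomy τ τ' with hlt | heq | hlt
    · exact absurd h (symbol_lt hN hs0 hs1 he hτ.1 hlt hτ'.2).ne'
    · exact heq
    · exact absurd h (symbol_lt hN hs0 hs1 he hτ'.1 hlt hτ.2).ne
  simp only [symbol_critical hN hs0 hs1 he, neg_neg] at hT hTc hTm
  have hcrit : T (criticalMu N s) = (2 * s - N) / 2 := by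
    refine hinj _ (hT _ le_rfl).1 _ ⟨le_rfl, by linarith⟩ ?_
    have := (hT _ le_rfl).2
    rw [symbol_critical hN hs0 hs1 he]
    linarith
  have hzero : T 0 = 0 := by
    have h0 := hT 0 (criticalMu_neg hN hs0 hs1).le
    refine hinj _ h0.1 _ ⟨by linarith, by linarith⟩ ?_
    rw [symbol_zero]
    linarith [h0.2]
  refine ⟨fun μ => 2 * s - N - T μ, T, fun μ hμ => ⟨?_, ?_⟩, continuousOn_const.sub hTc,
    fun μ hμ ν hν h => sub_lt_sub_left (hTm hμ hν h) _, hTc, hTm, fun μ _ => sub_add_cancel _ _,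
    ?_, hcrit, criticalMu_neg hN hs0 hs1, ?_, hzero, ?_, hTl⟩
  · obtain ⟨⟨ht1, ht2⟩, ht3⟩ := hT μ hμ
    have hmem : 2 * s - N - T μ ∈ Set.Ioc (-(N : ℝ)) ((2 * s - N) / 2) :=
      ⟨by linarith, by linarith⟩
    rcases eq_or_ne μ (criticalMu N s) with rfl | hμne
    · have hc2 : 2 * s - N - T (criticalMu N s) = (2 * s - N) / 2 := by
        rw [hcrit]
        ring
      simp only [hc2]
      exact ⟨⟨by linarith, le_rfl⟩, isAdmissible_rpow_mul_log (by omega) (by linarith)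
        (by linarith), solvesHardy_rpow_mul_log hN hs0 hs1,
        fun τ hτ h => eq_of_solvesHardy_rpow_mul_log hN hs0 hs1 hτ.1 hτ.2 h⟩
    · have hPhi : ∀ τ, Phi N s μ τ = Gam N τ := fun τ => by
        funext x
        rw [Phi, if_neg hμne, Gam]
      simp only [hPhi]
      refine ⟨hmem, isAdmissible_rpow (by omega) hmem.1 (by linarith),
        (solvesHardy_rpow_iff hN hs0 hs1 hmem.1 (by linarith) he μ).2 ?_, fun τ hτ h => ?_⟩
      · rw [symbol_symm, ht3]
      · have h' := (solvesHardy_rpow_iff hN hs0 hs1 hτ.1 (by linarith [hτ.2]) he μ).1 h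
        have := hinj (2 * s - N - τ) ⟨by linarith [hτ.2], by linarith [hτ.1]⟩ _ ⟨ht1, ht2⟩
          (by rw [symbol_symm]; linarith)
        linarith
  · obtain ⟨ht, ht3⟩ := hT μ hμ
    have hmem := hsub ht
    refine ⟨ht, isAdmissible_rpow (by omega) hmem.1 hmem.2,
      (solvesHardy_rpow_iff hN hs0 hs1 hmem.1 hmem.2 he μ).2 ht3, fun τ hτ h => ?_⟩
    have hmem' := hsub hτ
    have h' := (solvesHardy_rpow_iff hN hs0 hs1 hmem'.1 hmem'.2 he μ).1 h
    exact hinj _ hτ _ ht (by linarith)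
  · simp only [hcrit]
    ring
  · simp only [hzero, sub_zero]
  · have := hTl.const_sub (2 * s - (N : ℝ))
    rwa [sub_sub_cancel_left] at this
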